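/- Let $n,m\ge 2$ and $k_n,k_m\ge 1$ be integers, $d=n+m$, $r_n=n\wedge k_n$, $r_m=m\wedge k_m$, let $\mathcal D_n,\mathcal D_m\subset\mathbb R$ be arbitrary sets (alphabets), and let $B_{max},\theta_{\mathrm{mx}},\sigma>0$, $p\in(0,1]$. Write $\|A\|_2$ for the Frobenius norm, $\|A\|_\infty$ for the largest absolute value of an entry, and $\|A\|_{0,\infty}$ for the largest number of non-zero entries in a row of $A$. **Model.** One observes $Y_{ij}=E_{ij}(\theta^*_{ij}+\xi_{ij})$, $1\le i\le n$, $1\le j\le m$, where $\theta^*\in\mathbb R^{n\times m}$, the $E_{ij}$ are i.i.d. Bernoulli variables with parameter $p$, the $\xi_{ij}$ are independent with $\mathbb E\exp(t\xi_{ij})\le\exp(t^2\sigma^2/2)$ for all $t\in\mathbb R$, and $(E_{ij})$ is independent of $(\xi_{ij})$. Let $\Omega=\{(i,j):E_{ij}=1\}$, and let $\theta_\Omega$ be the matrix $\theta$ with the entries outside $\Omega$ replaced by $0$. **Classes.** For $1\le s_n\le k_n$ and $1\le s_m\le k_m$, let $\widetilde\Theta(s_n,s_m)$ be the set of matrices $\theta=XBZ^T$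 with $\|\theta\|_\infty\le\theta_{\mathrm{mx}}$, where $X\in\mathcal D_n^{n\times k_n}$, $\|X\|_\infty\le1$, $\|X\|_{0,\infty}\le s_n$; $B\in\mathbb R^{k_n\times k_m}$, $\|B\|_\infty\le B_{max}$; $Z\in\mathcal D_m^{m\times k_m}$, $\|Z\|_\infty\le1$, $\|Z\|_{0,\infty}\le s_m$. Let $\mathcal X=\bigcup_{s_n=1}^{k_n}\bigcup_{s_m=1}^{k_m}\widetilde\Theta(s_n,s_m)$. **Penalty.** Put $$\begin{aligned}R(s_n,s_m)=&\ \big[nr_m\log(6\sqrt{n\wedge m})\big]\wedge\big[ns_n\log(k_ns_m(n\wedge m))\big]\\&+\big[mr_n\log(6\sqrt{n\wedge m})\big]\wedge\big[ms_m\log(k_ms_n(n\wedge m))\big]+r_nr_m\log(9\sqrt{n\wedge m}),\end{aligned}$$ and for a factorization $\theta=XBZ^T\in\mathcal X$ as above put $R(\theta)=R(\|X\|_{0,\infty}\vee1,\ \|Z\|_{0,\infty}\vee1)$. Minima and infima over $\theta=XBZ^T\in\mathcal X$ are taken over all such factorizations $(X,B,Z)$. **Theorem.** There is an absolute constant $C>0$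 such that the following holds in the setting above. Assume that $nm\log(3\sqrt{n\wedge m})\ge6\log(k_nk_m)$, that $d\ge10$, and that $\|\theta^*\|_\infty\le\theta_{\mathrm{mx}}$. Let $\lambda=8(\sigma\vee\theta_{\mathrm{mx}})^2$ and $$\hat\theta\in\underset{\theta=XBZ^T\in\mathcal X}{\arg\min}\ \big\{\|Y-\theta_\Omega\|_2^2+\lambda R(\theta)\big\}.$$ Then, with probability at least $1-5\exp(-d/10)-2\exp(-pnm)$, $$\|\hat\theta-\theta^*\|_2^2\le C\inf_{\theta=XBZ^T\in\mathcal X}\Big\{\|\theta-\theta^*\|_2^2+\frac{(\sigma\vee\theta_{\mathrm{mx}})^2}{p}R(\theta)\Big\}.$$ -/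

import Mathlib

open MeasureTheory ProbabilityTheory

noncomputable section

/-- The squared Frobenius norm of a real matrix. -/
def frobSq {n m : ℕ} (A : Matrix (Fin n) (Fin m) ℝ) : ℝ :=
  ∑ i, ∑ j, A i j ^ 2

/-- The largest number of non-zero entries in a row of `A`. -/
def rowSparsity {n k : ℕ} (A : Matrix (Fin n) (Fin k) ℝ) : ℕ :=
  Finset.univ.sup fun i => hammingNorm (A i)

/-- The matrices with entries in the alphabet `D`, at most `s` non-zero entries in each row,
and all entries bounded by `1` in absolute value. -/
def sparseFactorSet (D : Set ℝ) (n k s : ℕ) : Set (Matrix (Fin n) (Fin k) ℝ) :=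
  {A | (∀ i j, A i j ∈ D) ∧ (∀ i, hammingNorm (A i) ≤ s) ∧ ∀ i j, |A i j| ≤ 1}

/-- A triple of factor matrices `X`, `B`, `Z`. -/
structure Factors (n m kn km : ℕ) where
  X : Matrix (Fin n) (Fin kn) ℝ
  B : Matrix (Fin kn) (Fin km) ℝ
  Z : Matrix (Fin m) (Fin km) ℝ

/-- The matrix `θ = X B Zᵀ` represented by a triple of factors. -/
def Factors.theta {n m kn km : ℕ} (F : Factors n m kn km) : Matrix (Fin n) (Fin m) ℝ :=
  F.X * F.B * F.Z.transpose

/-- The factorizations of the elements of the class with row sparsities `sn` and `sm`. -/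
def factorClass (Dn Dm : Set ℝ) (n m kn km : ℕ) (Bmax θmx : ℝ) (sn sm : ℕ) :
    Set (Factors n m kn km) :=
  {F | F.X ∈ sparseFactorSet Dn n kn sn ∧ (∀ a b, |F.B a b| ≤ Bmax) ∧
    F.Z ∈ sparseFactorSet Dm m km sm ∧ ∀ i j, |F.theta i j| ≤ θmx}

/-- The factorizations `θ = X B Zᵀ` of the elements of the union of all the classes with
`1 ≤ sn ≤ kn` and `1 ≤ sm ≤ km`. -/
def factorUnion (Dn Dm : Set ℝ) (n m kn km : ℕ) (Bmax θmx : ℝ) : Set (Factors n m kn km) :=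
  {F | ∃ sn ∈ Finset.Icc 1 kn, ∃ sm ∈ Finset.Icc 1 km,
    F ∈ factorClass Dn Dm n m kn km Bmax θmx sn sm}

/-- The complexity `R(sn, sm)`, with `r_n = n ∧ kn` and `r_m = m ∧ km`. -/
def complexity (n m kn km sn sm : ℕ) : ℝ :=
  min ((n : ℝ) * (min m km : ℕ) * Real.log (6 * √((min n m : ℕ) : ℝ)))
      ((n : ℝ) * sn * Real.log ((kn : ℝ) * sm * (min n m : ℕ))) +
  min ((m : ℝ) * (min n kn : ℕ) * Real.log (6 * √((min n m : ℕ) : ℝ)))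
      ((m : ℝ) * sm * Real.log ((km : ℝ) * sn * (min n m : ℕ))) +
  ((min n kn : ℕ) : ℝ) * (min m km : ℕ) * Real.log (9 * √((min n m : ℕ) : ℝ))

/-- The penalty `R(θ)` of a factorization `θ = X B Zᵀ`. The sparsity levels start at `1`, so that
a factor without non-zero entries counts as having level `1`. -/
def penalty {n m kn km : ℕ} (F : Factors n m kn km) : ℝ :=
  complexity n m kn km (max 1 (rowSparsity F.X)) (max 1 (rowSparsity F.Z))

/-- The observations `Y i j = E i j * (θ* i j + ξ i j)` at one sample point. -/
def observed {n m : ℕ} (e x : Fin n → Fin m → ℝ) (θs : Matrix (Fin n) (Fin m) ℝ) :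
    Matrix (Fin n) (Fin m) ℝ :=
  Matrix.of fun i j => e i j * (θs i j + x i j)

/-- The restriction of `θ` to the observed indices, those with `E i j = 1`. -/
def restrictObs {n m : ℕ} (e : Fin n → Fin m → ℝ) (θ : Matrix (Fin n) (Fin m) ℝ) :
    Matrix (Fin n) (Fin m) ℝ :=
  Matrix.of fun i j => if e i j = 1 then θ i j else 0

/-- The penalized least squares criterion `‖Y - θ_Ω‖² + lam * R(θ)`. -/
def criterion {n m kn km : ℕ} (lam : ℝ) (e : Fin n → Fin m → ℝ)
    (Y : Matrix (Fin n) (Fin m) ℝ) (F : Factors n m kn km) : ℝ :=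
  frobSq (Y - restrictObs e F.theta) + lam * penalty F

/-- `θhat` is the matrix of a minimizer of the penalized criterion over the family `S` of
factorizations. -/
def IsPenalizedLSE {n m kn km : ℕ} (S : Set (Factors n m kn km)) (lam : ℝ)
    (e : Fin n → Fin m → ℝ) (Y : Matrix (Fin n) (Fin m) ℝ)
    (θhat : Matrix (Fin n) (Fin m) ℝ) : Prop :=
  ∃ F ∈ S, F.theta = θhat ∧ ∀ G ∈ S, criterion lam e Y F ≤ criterion lam e Y G

/-- The randomness of the matrix completion model: the masks `E i j` are i.i.d. Bernoulli with
parameter `p`, the noise variables `ξ i j` are independent and sub-Gaussian with parameter `σ`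
(`𝔼 exp (t ξ) ≤ exp (t² σ² / 2)` for all real `t`), and masks and noise are independent. -/
structure IsCompletionModel {Ω : Type*} [MeasurableSpace Ω] (μ : Measure Ω) {n m : ℕ}
    (p σ : ℝ) (E ξ : Fin n → Fin m → Ω → ℝ) : Prop where
  measurable_mask : ∀ i j, Measurable (E i j)
  measurable_noise : ∀ i j, Measurable (ξ i j)
  mask_zero_one : ∀ i j, ∀ᵐ ω ∂μ, E i j ω = 0 ∨ E i j ω = 1
  mask_prob : ∀ i j, μ.real {ω | E i j ω = 1} = p
  mask_indep : iIndepFun (fun (q : Fin n × Fin m) => E q.1 q.2) μ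
  noise_indep : iIndepFun (fun (q : Fin n × Fin m) => ξ q.1 q.2) μ
  mask_noise_indep : IndepFun (fun ω (q : Fin n × Fin m) => E q.1 q.2 ω)
    (fun ω (q : Fin n × Fin m) => ξ q.1 q.2 ω) μ
  noise_subgaussian : ∀ i j, HasSubgaussianMGF (ξ i j) (Real.toNNReal (σ ^ 2)) μ

end

/-!
The estimator is compared with a fixed competitor `F₀` whose value is within a factor `2` of the
infimum. If the penalty of `F₀` is at least a small multiple of `p n m`, the bound `θmx` on the
entries already gives the inequality. Otherwise `n ∧ m` exceeds a large absolute constant, because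
the penalty is at least `(n + m) / 2`; then every logarithm in the penalty is large, and terms
proportional to the number of parameters are negligible against it.

In that case two uniform bounds are needed, over all matrices of the class: the noise
`⟨ξ_Ω, θ - θ₀⟩` is controlled by `‖(θ - θ₀)_Ω‖²` and the penalty, and `‖(θ - θs)_Ω‖²` is comparable
with `p ‖θ - θs‖²` up to the penalty. Once the supports of the sparse factors are fixed
(`FactorPattern`), the matrices form the image of a polynomial map of degree at most `3` in `D`
parameters, where `D` is much smaller than the penalty (`polyParam_chartSet`,
`chartDim_le_chartCost`), and the number of supports is paid for by the penalty
(`sum_exp_chartCost_le`).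

Since neither `Bmax` nor the conditioning of the factors enters the penalty, a metric net in the
parameters is of no use. It is replaced by a polynomial argument (`exists_norming`): the `q`-th
tensor powers of the points of a polynomial image of `ℝ^D` span a space whose dimension `N` is the
number of monomials of degree `O(q)` in `D` variables. A barycentric spanner of these powers, that
is, a tuple of almost maximal determinant, consists of `N` points, and the supremum of a linear form
over the set is at most `(2 N)^(1/q)` times its maximum over these points. For `q` a large multiple
of `D`, `N` is exponential in `D` and the factor is close to `1`, so that the supremum behaves like
a maximum over `exp (9 D)` points. At single points the tails are those of sub-Gaussian sums
(`subgaussian_sum_tail`, for a fixed mask, by independence) and of centred Bernoulli sums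
(`bernoulli_sum_tail`).
-/

/-! ### Norming points of polynomial images -/

/-- A bounded spanning set contains a *barycentric spanner*: a basis with respect to which all
points of the set have coordinates of absolute value at most `2`. A `d`-tuple whose determinant is
at least half of the supremum does it, since by Cramer's rule the coordinates are quotients of
determinants. -/
theorem exists_barycentric_of_span_eq_top {E : Type*} [NormedAddCommGroup E] [NormedSpace ℝ E]
    [FiniteDimensional ℝ E] {S : Set E} (hS : Bornology.IsBounded S)
    (hspan : Submodule.span ℝ S = ⊤) :
    ∃ v : Fin (Module.finrank ℝ E) → E, (∀ k, v k ∈ S) ∧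
      ∀ s ∈ S, ∃ c : Fin (Module.finrank ℝ E) → ℝ, (∀ k, |c k| ≤ 2) ∧ s = ∑ k, c k • v k := by
  classical
  set d := Module.finrank ℝ E
  let b : Module.Basis (Fin d) ℝ E := Module.finBasis ℝ E
  -- the volumes spanned by `d`-tuples from `S`
  let V : Set ℝ := {x | ∃ v : Fin d → E, (∀ k, v k ∈ S) ∧ x = |b.det v|}
  have hcont : Continuous fun v : Fin d → E => |b.det v| := by
    suffices h : Continuous fun v : Fin d → E => b.det v from h.abs
    simp only [Module.Basis.det_apply]
    refine Continuous.matrix_det (continuous_matrix fun i j => ?_)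
    exact (LinearMap.continuous_of_finiteDimensional (b.coord i)).comp (continuous_apply j)
  have hbdd : BddAbove V := by
    have hK : IsCompact (Set.univ.pi fun _ : Fin d => closure S) :=
      isCompact_univ_pi fun _ => hS.isCompact_closure
    refine (hK.bddAbove_image hcont.continuousOn).mono ?_
    rintro x ⟨v, hv, rfl⟩
    exact ⟨v, fun k _ => subset_closure (hv k), rfl⟩
  obtain ⟨v₀, hv₀, hdet₀⟩ : ∃ v : Fin d → E, (∀ k, v k ∈ S) ∧ b.det v ≠ 0 := by
    obtain ⟨t, htS, hts, hli⟩ := exists_linearIndependent ℝ S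
    rw [hspan] at hts
    let b' : Module.Basis t ℝ E := Module.Basis.mk hli (by simp [hts])
    let e : Fin d ≃ t := b.indexEquiv b'
    refine ⟨fun k => (e k : E), fun k => htS (e k).2, ?_⟩
    have hb : (b'.reindex e.symm : Fin d → E) = fun k => (e k : E) := by
      ext k; simp [b']
    have := (b.is_basis_iff_det (v := fun k => (e k : E))).1
      (by rw [← hb]; exact ⟨Module.Basis.linearIndependent _, Module.Basis.span_eq _⟩)
    exact this.ne_zero
  have hpos : 0 < sSup V :=
    (abs_pos.2 hdet₀).trans_le (le_csSup hbdd ⟨v₀, hv₀, rfl⟩)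
  obtain ⟨_, ⟨v, hv, rfl⟩, hlt⟩ := exists_lt_of_lt_csSup
    (⟨_, v₀, hv₀, rfl⟩ : V.Nonempty) (half_lt_self hpos)
  have hne : b.det v ≠ 0 := by
    intro h; rw [h, abs_zero] at hlt; linarith
  obtain ⟨hli, hsp⟩ := b.is_basis_iff_det.2 (isUnit_iff_ne_zero.2 hne)
  refine ⟨v, hv, fun s hs => ⟨fun k => (Module.Basis.mk hli hsp.ge).coord k s, fun k => ?_, ?_⟩⟩
  · have hcr := congrArg (fun l => l s) (b.det_smul_mk_coord_eq_det_update hli hsp.ge k)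
    simp only [LinearMap.smul_apply, smul_eq_mul, MultilinearMap.toLinearMap_apply] at hcr
    have hle : |b.det (Function.update v k s)| ≤ sSup V := by
      refine le_csSup hbdd ⟨_, fun j => ?_, rfl⟩
      rcases eq_or_ne j k with rfl | hjk
      · simpa using hs
      · simpa [hjk] using hv j
    have h1 : |b.det v| * |(Module.Basis.mk hli hsp.ge).coord k s| ≤ sSup V := by
      rw [← abs_mul, hcr]; exact hle
    by_contra! h2
    nlinarith [abs_nonneg (b.det v)]
  · have := (Module.Basis.mk hli hsp.ge).sum_repr s
    simpa using this.symm

/-- Barycentric spanner of a bounded set inside its linear span. -/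
theorem exists_barycentric {E : Type*} [NormedAddCommGroup E] [NormedSpace ℝ E]
    [FiniteDimensional ℝ E] {S : Set E} (hS : Bornology.IsBounded S) :
    ∃ v : Fin (Module.finrank ℝ (Submodule.span ℝ S)) → E, (∀ k, v k ∈ S) ∧
      ∀ s ∈ S, ∃ c : Fin (Module.finrank ℝ (Submodule.span ℝ S)) → ℝ,
        (∀ k, |c k| ≤ 2) ∧ s = ∑ k, c k • v k := by
  have hb : Bornology.IsBounded ((↑) ⁻¹' S : Set (Submodule.span ℝ S)) := by
    obtain ⟨R, hR⟩ := hS.exists_norm_le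
    exact isBounded_iff_forall_norm_le.2 ⟨R, fun x hx => hR x hx⟩
  obtain ⟨v, hv, h⟩ := exists_barycentric_of_span_eq_top hb Submodule.span_span_coe_preimage
  refine ⟨fun k => v k, hv, fun s hs => ?_⟩
  obtain ⟨c, hc, hsum⟩ := h ⟨s, Submodule.subset_span hs⟩ hs
  refine ⟨c, hc, ?_⟩
  simpa using congrArg Subtype.val hsum

/-- The `q`-th tensor power of a vector `x ∈ ℝ^ι`, in coordinates indexed by `Fin q → ι`. -/
noncomputable def tensorPow {ι : Type*} (q : ℕ) (x : ι → ℝ) : (Fin q → ι) → ℝ :=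
  fun f => ∏ k, x (f k)

theorem tensorPow_dotProduct {ι : Type*} [Fintype ι] (q : ℕ) (x y : ι → ℝ) :
    ∑ f : Fin q → ι, tensorPow q x f * tensorPow q y f = (∑ i, x i * y i) ^ q := by
  classical
  rw [Fintype.sum_pow]
  exact Finset.sum_congr rfl fun f _ => by simp [tensorPow, Finset.prod_mul_distrib]

theorem tensorPow_smul {ι : Type*} (q : ℕ) (c : ℝ) (x : ι → ℝ) :
    tensorPow q (c • x) = c ^ q • tensorPow q x := by
  ext f
  simp [tensorPow, Finset.prod_mul_distrib]

/-- The exponents of the monomials of degree at most `k` in the variables `P`. -/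
def lowDegree (P : Type*) [Fintype P] [DecidableEq P] (k : ℕ) : Finset (P →₀ ℕ) :=
  (Finset.range (k + 1)).biUnion fun j => Finset.finsuppAntidiag Finset.univ j

theorem mem_lowDegree {P : Type*} [Fintype P] [DecidableEq P] {k : ℕ} {a : P →₀ ℕ} :
    a ∈ lowDegree P k ↔ ∑ i, a i ≤ k := by
  simp [lowDegree]

theorem card_lowDegree_le (P : Type*) [Fintype P] [DecidableEq P] (k : ℕ) :
    (lowDegree P k).card ≤ (Fintype.card P + k).choose (Fintype.card P) := by
  refine Finset.card_biUnion_le.trans ?_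
  simp only [Finset.card_finsuppAntidiag_nat_eq_multichoose, Finset.card_univ]
  rw [Nat.sum_range_multichoose, add_comm]

theorem eval_eq_sum_lowDegree {P : Type*} [Fintype P] [DecidableEq P] {k : ℕ}
    {Q : MvPolynomial P ℝ} (hQ : Q.totalDegree ≤ k) (w : P → ℝ) :
    MvPolynomial.eval w Q = ∑ a ∈ lowDegree P k, (∏ i, w i ^ a i) * MvPolynomial.coeff a Q := by
  rw [MvPolynomial.eval_eq', Finset.sum_subset (s₂ := lowDegree P k)]
  · exact Finset.sum_congr rfl fun a _ => mul_comm _ _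
  · intro a ha
    rw [mem_lowDegree]
    have := (MvPolynomial.le_totalDegree ha).trans hQ
    rwa [Finsupp.sum_fintype _ _ (by simp)] at this
  · intro a _ ha
    simp [MvPolynomial.notMem_support_iff.1 ha]

/-- The tensor powers of the points of a polynomial image, and of their scalar multiples, span a
space of dimension at most the number of monomials of degree `δ q`: expanding into monomials of the
parameters `w` exhibits each of them as a combination of fixed coefficient vectors. -/
theorem finrank_span_tensorPow_le {ι P : Type*} [Fintype ι] [Fintype P]
    {δ q : ℕ} {Q : ι → MvPolynomial P ℝ} (hQ : ∀ i, (Q i).totalDegree ≤ δ) {S : Set (ι → ℝ)}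
    (hS : ∀ v ∈ S, ∃ (c : ℝ) (w : P → ℝ), v = c • fun i => MvPolynomial.eval w (Q i)) :
    Module.finrank ℝ (Submodule.span ℝ (tensorPow q '' S)) ≤
      (Fintype.card P + δ * q).choose (Fintype.card P) := by
  classical
  let G : (P →₀ ℕ) → (Fin q → ι) → ℝ := fun a f => MvPolynomial.coeff a (∏ k, Q (f k))
  refine (Submodule.finrank_mono (t := Submodule.span ℝ
    (((lowDegree P (δ * q)).image G : Finset _) : Set ((Fin q → ι) → ℝ))) ?_).trans
    ((finrank_span_finset_le_card _).trans
      (Finset.card_image_le.trans (card_lowDegree_le P _)))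
  rw [Submodule.span_le]
  rintro _ ⟨v, hv, rfl⟩
  obtain ⟨c, w, rfl⟩ := hS v hv
  rw [tensorPow_smul]
  refine Submodule.smul_mem _ _ ?_
  have : tensorPow q (fun i => MvPolynomial.eval w (Q i)) =
      ∑ a ∈ lowDegree P (δ * q), (∏ i, w i ^ a i) • G a := by
    ext f
    have hdeg : (∏ k, Q (f k)).totalDegree ≤ δ * q := by
      refine (MvPolynomial.totalDegree_finsetProd _ _).trans
        ((Finset.sum_le_sum fun k _ => hQ (f k)).trans ?_)
      simp [mul_comm]
    have h := eval_eq_sum_lowDegree hdeg w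
    rw [map_prod] at h
    simp [tensorPow, h, G]
  rw [this]
  refine Submodule.sum_mem _ fun a ha => Submodule.smul_mem _ _ (Submodule.subset_span ?_)
  exact Finset.mem_coe.2 (Finset.mem_image_of_mem _ ha)

/-- Norming points for linear forms. Since `⟨x, v⟩ ^ q = ⟨x^⊗q, v^⊗q⟩` is linear in `v^⊗q`, a
barycentric spanner of the tensor powers controls all the forms `⟨x, ·⟩` on `S` at once. -/
theorem exists_pow_norming {ι P : Type*} [Fintype ι] [Fintype P]
    {δ : ℕ} (q : ℕ) {Q : ι → MvPolynomial P ℝ} (hQ : ∀ i, (Q i).totalDegree ≤ δ) {S : Set (ι → ℝ)}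
    (hS : ∀ v ∈ S, ∃ (c : ℝ) (w : P → ℝ), v = c • fun i => MvPolynomial.eval w (Q i))
    (hb : Bornology.IsBounded S) :
    ∃ N : Finset (ι → ℝ), (N : Set (ι → ℝ)) ⊆ S ∧
      N.card ≤ (Fintype.card P + δ * q).choose (Fintype.card P) ∧
      ∀ x : ι → ℝ, (∀ u ∈ N, |∑ i, x i * u i| ≤ 1) → ∀ v ∈ S,
        |∑ i, x i * v i| ^ q ≤ 2 * (Fintype.card P + δ * q).choose (Fintype.card P) := by
  classical
  have hbT : Bornology.IsBounded (tensorPow q '' S) := by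
    have hc : Continuous (tensorPow q : (ι → ℝ) → _) := by
      unfold tensorPow; fun_prop
    exact (hb.isCompact_closure.image hc).isBounded.subset (Set.image_mono subset_closure)
  obtain ⟨v, hv, h⟩ := exists_barycentric hbT
  have hd := finrank_span_tensorPow_le (q := q) hQ hS
  set d := Module.finrank ℝ (Submodule.span ℝ (tensorPow q '' S))
  choose y hyS hy using hv
  refine ⟨Finset.univ.image y, ?_, ?_, ?_⟩
  · simpa [Set.range_subset_iff] using hyS
  · exact Finset.card_image_le.trans (by simpa using hd)
  · intro x hx s hs
    obtain ⟨c, hc, hsum⟩ := h _ (Set.mem_image_of_mem _ hs)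
    have h1 : (∑ i, x i * s i) ^ q = ∑ k, c k * (∑ i, x i * y k i) ^ q := by
      simp only [← tensorPow_dotProduct, hsum, Finset.mul_sum, hy]
      rw [Finset.sum_comm]
      refine Finset.sum_congr rfl fun f _ => ?_
      simp only [Finset.sum_apply, Pi.smul_apply, smul_eq_mul, Finset.mul_sum]
      exact Finset.sum_congr rfl fun k _ => by ring
    rw [← abs_pow, h1]
    calc |∑ k, c k * (∑ i, x i * y k i) ^ q| ≤ ∑ k : Fin d, (2 : ℝ) := by
          refine (Finset.abs_sum_le_sum_abs _ _).trans (Finset.sum_le_sum fun k _ => ?_)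
          rw [abs_mul, abs_pow]
          have := hx (y k) (Finset.mem_image_of_mem _ (Finset.mem_univ k))
          nlinarith [hc k, pow_le_one₀ (n := q) (abs_nonneg _) this, abs_nonneg (c k),
            pow_nonneg (abs_nonneg (∑ i, x i * y k i)) q]
      _ = 2 * (d : ℝ) := by simp [mul_comm]
      _ ≤ _ := by gcongr

/-- With `q = 150 D`, the dimension of the space of tensor powers is at most exponential in `D`, so
that its `q`-th root is close to `1`. -/
theorem two_mul_choose_le (D : ℕ) (hD : 1 ≤ D) :
    2 * ((D + 6 * (150 * D)).choose D : ℝ) ≤ Real.exp (9 * D) := by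
  have h1 : ((D + 6 * (150 * D)).choose D : ℝ) ≤ 901 ^ D * Real.exp D := by
    have h := Nat.choose_le_pow_div (α := ℝ) D (D + 6 * (150 * D))
    have h2 := Real.pow_div_factorial_le_exp (x := (D : ℝ)) (by positivity) D
    refine h.trans ?_
    have : (((D + 6 * (150 * D) : ℕ) : ℝ)) = 901 * D := by push_cast; ring
    rw [this, mul_pow, mul_div_assoc]
    gcongr
  have h3 : (901 : ℝ) * 2 ≤ Real.exp 8 := by
    have : (2.7 : ℝ) ≤ Real.exp 1 := by linarith [Real.exp_one_gt_d9]
    have h := pow_le_pow_left₀ (by norm_num) this 8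
    rw [← Real.exp_nat_mul] at h
    norm_num at h ⊢
    linarith
  have h4 : (2 : ℝ) ≤ 2 ^ D := by
    calc (2 : ℝ) = 2 ^ 1 := by norm_num
      _ ≤ 2 ^ D := pow_le_pow_right₀ (by norm_num) hD
  calc 2 * ((D + 6 * (150 * D)).choose D : ℝ) ≤ 2 ^ D * (901 ^ D * Real.exp D) := by gcongr
    _ = (901 * 2) ^ D * Real.exp D := by rw [mul_pow]; ring
    _ ≤ (Real.exp 8) ^ D * Real.exp D := by gcongr
    _ = Real.exp (9 * D) := by rw [← Real.exp_nat_mul, ← Real.exp_add]; congr 1; ring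

/-- On a bounded subset `S` of the cone over a polynomial image of `ℝ^D`, linear forms are
controlled up to the factor `15 / 14` by their values at `exp (9 D)` points of `S`. No bound on the
parameters is needed. -/
theorem exists_norming {ι P : Type*} [Fintype ι] [Fintype P] {D : ℕ} (hD : 1 ≤ D)
    (hP : Fintype.card P ≤ D) {Q : ι → MvPolynomial P ℝ} (hQ : ∀ i, (Q i).totalDegree ≤ 6)
    {S : Set (ι → ℝ)}
    (hS : ∀ v ∈ S, ∃ (c : ℝ) (w : P → ℝ), v = c • fun i => MvPolynomial.eval w (Q i))
    (hb : Bornology.IsBounded S) :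
    ∃ N : Finset (ι → ℝ), (N : Set (ι → ℝ)) ⊆ S ∧ (N.card : ℝ) ≤ Real.exp (9 * D) ∧
      ∀ x : ι → ℝ, (∀ u ∈ N, |∑ i, x i * u i| ≤ 1) → ∀ v ∈ S,
        |∑ i, x i * v i| ≤ 15 / 14 := by
  obtain ⟨N, hNS, hN, h⟩ := exists_pow_norming (150 * D) hQ hS hb
  have hmono : (Fintype.card P + 6 * (150 * D)).choose (Fintype.card P) ≤
      (D + 6 * (150 * D)).choose D := by
    rw [Nat.choose_symm_add, Nat.choose_symm_add]
    exact Nat.choose_le_choose _ (by omega)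
  have hmono' : ((Fintype.card P + 6 * (150 * D)).choose (Fintype.card P) : ℝ) ≤
      (D + 6 * (150 * D)).choose D := by exact_mod_cast hmono
  have hd := two_mul_choose_le D hD
  refine ⟨N, hNS, ?_, fun x hx v hv => ?_⟩
  · have : (N.card : ℝ) ≤ ((D + 6 * (150 * D)).choose D : ℝ) := by exact_mod_cast hN.trans hmono
    linarith [(Nat.cast_nonneg ((D + 6 * (150 * D)).choose D) : (0 : ℝ) ≤ _)]
  · have h1 := (h x hx v hv).trans ((mul_le_mul_of_nonneg_left hmono' zero_le_two).trans hd)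
    by_contra! hlt
    -- the loss is the root of order `150 D` of `exp (9 D)`
    have h2 : Real.exp (9 / 150) < 15 / 14 := by
      have := Real.exp_bound_div_one_sub_of_interval (x := 9 / 150) (by norm_num) (by norm_num)
      refine this.trans_lt ?_
      norm_num
    have h3 : Real.exp (9 / 150) ^ (150 * D) < |∑ i, x i * v i| ^ (150 * D) :=
      pow_lt_pow_left₀ (h2.trans hlt) (Real.exp_pos _).le (by omega)
    rw [← Real.exp_nat_mul] at h3
    have : ((150 * D : ℕ) : ℝ) * (9 / 150) = 9 * D := by push_cast; ring
    rw [this] at h3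
    linarith

/-! ### Tail bounds for noise and mask -/

/-- Tail of a weighted sum of sub-Gaussian variables, at a level that combines the energy
`∑ a i ^ 2` of the weights with a complexity `R`; the exponent does not depend on the weights. -/
theorem subgaussian_sum_tail {Ω ι : Type*} [MeasurableSpace Ω] {μ : Measure Ω}
    [IsProbabilityMeasure μ] [Fintype ι] {X : ι → Ω → ℝ} {σ ς R : ℝ} (hσ : 0 < σ) (hς : σ ≤ ς)
    (hR : 0 < R) (hind : iIndepFun X μ)
    (hsub : ∀ i, HasSubgaussianMGF (X i) (Real.toNNReal (σ ^ 2)) μ) (a : ι → ℝ) :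
    μ.real {ω | (1 / 2) * ∑ i, a i ^ 2 + 7 * ς ^ 2 * R ≤ 2 * ∑ i, a i * X i ω} ≤
      Real.exp (-(7 / 4 * R)) := by
  set V := ∑ i, a i ^ 2 with hV
  have hV0 : 0 ≤ V := Finset.sum_nonneg fun i _ => sq_nonneg _
  have hς0 : 0 < ς := hσ.trans_le hς
  -- zero weights are treated apart: the general tail bound then has exponent `_ / 0 = 0`
  rcases hV0.eq_or_lt with h0 | hVpos
  · have ha : ∀ i, a i = 0 := fun i => by
      have := (Finset.sum_eq_zero_iff_of_nonneg fun i _ => sq_nonneg (a i)).1 h0.symm i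
        (Finset.mem_univ i)
      simpa using this
    have : {ω | (1 / 2) * V + 7 * ς ^ 2 * R ≤ 2 * ∑ i, a i * X i ω} = ∅ := by
      ext ω
      simp only [Set.mem_ofPred_eq, ha, ← h0, Set.mem_empty_iff_false, iff_false, not_le]
      simp only [mul_zero, zero_mul, Finset.sum_const_zero, zero_add]
      positivity
    rw [this]; simp [(Real.exp_pos _).le]
  · have hind' : iIndepFun (fun i ω => a i * X i ω) μ :=
      hind.comp (fun i x => a i * x) fun i => by fun_prop
    have hsub' : ∀ i, HasSubgaussianMGF (fun ω => a i * X i ω)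
        (Real.toNNReal (a i ^ 2 * σ ^ 2)) μ := fun i => by
      have h := (hsub i).const_mul (a i)
      rw [Real.toNNReal_mul (sq_nonneg _), Real.toNNReal_of_nonneg (sq_nonneg (a i))]
      exact h
    have h := HasSubgaussianMGF.measure_sum_ge_le_of_iIndepFun hind' (s := Finset.univ)
      (fun i _ => hsub' i) (ε := V / 4 + 7 / 2 * ς ^ 2 * R) (by positivity)
    have hset : {ω | (1 / 2) * V + 7 * ς ^ 2 * R ≤ 2 * ∑ i, a i * X i ω} =
        {ω | V / 4 + 7 / 2 * ς ^ 2 * R ≤ ∑ i, a i * X i ω} := by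
      ext ω; simp only [Set.mem_ofPred_eq]; constructor <;> intro h <;> linarith
    rw [hset]
    refine h.trans (Real.exp_le_exp.2 ?_)
    have hc : ((∑ i, Real.toNNReal (a i ^ 2 * σ ^ 2) : NNReal) : ℝ) = V * σ ^ 2 := by
      rw [NNReal.coe_sum, hV, Finset.sum_mul]
      exact Finset.sum_congr rfl fun i _ => Real.coe_toNNReal _ (by positivity)
    rw [hc]
    have hVσ : 0 < 2 * (V * σ ^ 2) := by positivity
    rw [neg_div, neg_le_neg_iff, le_div_iff₀ hVσ]
    have h1 : σ ^ 2 ≤ ς ^ 2 := by gcongr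
    have h2 : V * R * σ ^ 2 ≤ V * R * ς ^ 2 := by gcongr
    -- `(u + v) ^ 2 ≥ 4 u v` for the two parts `u`, `v` of the level
    nlinarith [sq_nonneg (V / 4 - 7 / 2 * ς ^ 2 * R)]

theorem subgaussian_sum_abs_tail {Ω ι : Type*} [MeasurableSpace Ω] {μ : Measure Ω}
    [IsProbabilityMeasure μ] [Fintype ι] {X : ι → Ω → ℝ} {σ ς R : ℝ} (hσ : 0 < σ) (hς : σ ≤ ς)
    (hR : 0 < R) (hind : iIndepFun X μ)
    (hsub : ∀ i, HasSubgaussianMGF (X i) (Real.toNNReal (σ ^ 2)) μ) (a : ι → ℝ) :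
    μ.real {ω | (1 / 2) * ∑ i, a i ^ 2 + 7 * ς ^ 2 * R ≤ |2 * ∑ i, a i * X i ω|} ≤
      2 * Real.exp (-(7 / 4 * R)) := by
  have h1 := subgaussian_sum_tail hσ hς hR hind hsub a
  have h2 := subgaussian_sum_tail hσ hς hR hind hsub (fun i => -a i)
  simp only [neg_sq, neg_mul, Finset.sum_neg_distrib, mul_neg] at h2
  have hsub : {ω | (1 / 2) * ∑ i, a i ^ 2 + 7 * ς ^ 2 * R ≤ |2 * ∑ i, a i * X i ω|} ⊆
      {ω | (1 / 2) * ∑ i, a i ^ 2 + 7 * ς ^ 2 * R ≤ 2 * ∑ i, a i * X i ω} ∪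
      {ω | (1 / 2) * ∑ i, a i ^ 2 + 7 * ς ^ 2 * R ≤ -(2 * ∑ i, a i * X i ω)} :=
    fun ω h => by
      simp only [Set.mem_ofPred_eq, Set.mem_union] at h ⊢
      exact le_abs.1 h
  have h3 := (measureReal_mono hsub (μ := μ)).trans (measureReal_union_le _ _)
  linarith

/-- Bernstein-type bound for the moment generating function of a centred Bernoulli variable. -/
theorem integral_bernoulli_exp_le {Ω : Type*} [MeasurableSpace Ω] {μ : Measure Ω}
    [IsProbabilityMeasure μ] {E : Ω → ℝ} {p a : ℝ} (hp0 : 0 ≤ p) (hp1 : p ≤ 1) (hE : Measurable E)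
    (h01 : ∀ᵐ ω ∂μ, E ω = 0 ∨ E ω = 1) (hp : μ.real {ω | E ω = 1} = p) (ha : |a| ≤ 1) :
    Integrable (fun ω => Real.exp ((E ω - p) * a)) μ ∧
    ∫ ω, Real.exp ((E ω - p) * a) ∂μ ≤ Real.exp (p * a ^ 2) := by
  have habs : ∀ᵐ ω ∂μ, |(E ω - p) * a| ≤ 1 := by
    filter_upwards [h01] with ω h
    rw [abs_mul]
    refine mul_le_one₀ ?_ (abs_nonneg _) ha
    rcases h with h | h <;> rw [h, abs_le] <;> constructor <;> linarith
  have hmE : MeasurableSet {ω | E ω = 1} := hE (measurableSet_singleton 1)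
  have hEi : E =ᵐ[μ] Set.indicator {ω | E ω = 1} (fun _ => (1 : ℝ)) := by
    filter_upwards [h01] with ω h
    rcases h with h | h <;> simp [Set.indicator, h]
  have hintE : Integrable E μ :=
    ((integrable_const (1 : ℝ)).indicator hmE).congr hEi.symm
  have hE1 : ∫ ω, E ω ∂μ = p := by
    rw [integral_congr_ae hEi, integral_indicator_const _ hmE, hp]; simp
  have hint : Integrable (fun ω => Real.exp ((E ω - p) * a)) μ := by
    refine Integrable.of_bound (by fun_prop) (Real.exp 1) ?_
    filter_upwards [habs] with ω h
    rw [Real.norm_eq_abs, Real.abs_exp]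
    exact Real.exp_le_exp.2 ((le_abs_self _).trans h)
  refine ⟨hint, ?_⟩
  have hle : ∫ ω, Real.exp ((E ω - p) * a) ∂μ ≤
      ∫ ω, ((1 - p * a + p ^ 2 * a ^ 2) + (a + (1 - 2 * p) * a ^ 2) * E ω) ∂μ := by
    refine integral_mono_ae hint ((integrable_const _).add (hintE.const_mul _)) ?_
    filter_upwards [habs, h01] with ω h h'
    have h2 := (abs_le.1 (Real.abs_exp_sub_one_sub_id_le h)).2
    have h3 : E ω ^ 2 = E ω := by rcases h' with h' | h' <;> simp [h']
    have h4 : ((E ω - p) * a) ^ 2 = (E ω * (1 - 2 * p) + p ^ 2) * a ^ 2 := by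
      rw [mul_pow]; congr 1; linear_combination h3
    rw [h4] at h2
    linarith
  rw [integral_add (integrable_const _) (hintE.const_mul _), integral_const_mul, hE1] at hle
  simp only [integral_const, probReal_univ, smul_eq_mul, one_mul] at hle
  refine hle.trans (le_trans ?_ (Real.add_one_le_exp _))
  nlinarith [sq_nonneg (p * a)]

/-- Bernstein inequality for a centred mask with nonnegative weights `y i ≤ 4 θ ^ 2`, at a level
that combines a quarter of the mean `p ∑ y i` with a complexity `R`. The sign `τ` gives both
tails. -/
theorem bernoulli_sum_tail {Ω ι : Type*} [MeasurableSpace Ω] {μ : Measure Ω}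
    [IsProbabilityMeasure μ] [Fintype ι] {E : ι → Ω → ℝ} {p θ R : ℝ} (hp0 : 0 ≤ p) (hp1 : p ≤ 1)
    (hθ : 0 < θ) (hE : ∀ i, Measurable (E i)) (h01 : ∀ i, ∀ᵐ ω ∂μ, E i ω = 0 ∨ E i ω = 1)
    (hp : ∀ i, μ.real {ω | E i ω = 1} = p) (hind : iIndepFun E μ) {y : ι → ℝ}
    (hy0 : ∀ i, 0 ≤ y i) (hy1 : ∀ i, y i ≤ 4 * θ ^ 2) {τ : ℝ} (hτ : |τ| = 1) :
    μ.real {ω | p / 4 * ∑ i, y i + 32 * θ ^ 2 * R ≤ τ * ∑ i, (E i ω - p) * y i} ≤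
      Real.exp (-(2 * R)) := by
  have hτ2 : τ ^ 2 = 1 := by rw [← sq_abs, hτ, one_pow]
  -- Chernoff's bound with parameter `1 / (16 θ ^ 2)`, for which the second moment of the weights
  -- uses up exactly the quarter of the mean
  let a : ι → ℝ := fun i => τ * y i / (16 * θ ^ 2)
  have ha : ∀ i, |a i| ≤ 1 := fun i => by
    simp only [a]
    rw [abs_div, abs_mul, hτ, one_mul, abs_of_nonneg (hy0 i), abs_of_pos (by positivity),
      div_le_one (by positivity)]
    nlinarith [hy1 i]
  have key := fun i => integral_bernoulli_exp_le hp0 hp1 (hE i) (h01 i) (hp i) (ha i)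
  have hind' : iIndepFun (fun i ω => (E i ω - p) * a i) μ :=
    hind.comp (fun i x => (x - p) * a i) fun i => by fun_prop
  have hm : ∀ i, Measurable fun ω => (E i ω - p) * a i := fun i => by fun_prop
  have hmgf := hind'.mgf_sum (t := 1) hm Finset.univ
  have hint := hind'.integrable_exp_mul_sum (t := 1) hm (s := Finset.univ)
    (fun i _ => by simpa using (key i).1)
  have hch := measure_ge_le_exp_mul_mgf (μ := μ) (t := 1)
    ((p / 4 * ∑ i, y i + 32 * θ ^ 2 * R) / (16 * θ ^ 2)) zero_le_one hint
  have hset : {ω | p / 4 * ∑ i, y i + 32 * θ ^ 2 * R ≤ τ * ∑ i, (E i ω - p) * y i} =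
      {ω | (p / 4 * ∑ i, y i + 32 * θ ^ 2 * R) / (16 * θ ^ 2) ≤
        (∑ i, fun ω => (E i ω - p) * a i) ω} := by
    ext ω
    have : (∑ i, fun ω => (E i ω - p) * a i) ω =
        (τ * ∑ i, (E i ω - p) * y i) / (16 * θ ^ 2) := by
      rw [Finset.sum_apply, Finset.mul_sum, Finset.sum_div]
      exact Finset.sum_congr rfl fun i _ => by simp only [a]; ring
    simp only [Set.mem_ofPred_eq, this]
    rw [div_le_div_iff_of_pos_right (by positivity)]
  rw [hset]
  refine hch.trans ?_
  rw [hmgf]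
  have hprod : ∏ i, mgf (fun ω => (E i ω - p) * a i) μ 1 ≤ Real.exp (∑ i, p * a i ^ 2) := by
    rw [Real.exp_sum]
    refine Finset.prod_le_prod (fun i _ => mgf_nonneg) fun i _ => ?_
    simpa [mgf] using (key i).2
  refine (mul_le_mul_of_nonneg_left hprod (Real.exp_pos _).le).trans ?_
  rw [← Real.exp_add, Real.exp_le_exp]
  have hsum : ∑ i, p * a i ^ 2 ≤ (p / 4 * ∑ i, y i) / (16 * θ ^ 2) := by
    rw [Finset.mul_sum, Finset.sum_div]
    refine Finset.sum_le_sum fun i _ => ?_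
    have : p * a i ^ 2 = p * y i / (16 * θ ^ 2) * (y i / (16 * θ ^ 2)) := by
      simp only [a]; rw [div_pow, mul_pow, hτ2]; ring
    rw [this]
    have h1 : y i / (16 * θ ^ 2) ≤ 1 / 4 := by
      rw [div_le_iff₀ (by positivity)]; linarith [hy1 i]
    have h2 : 0 ≤ p * y i / (16 * θ ^ 2) := by have := hy0 i; positivity
    calc _ ≤ p * y i / (16 * θ ^ 2) * (1 / 4) := by gcongr
      _ = _ := by ring
  have : (p / 4 * ∑ i, y i + 32 * θ ^ 2 * R) / (16 * θ ^ 2) =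
      (p / 4 * ∑ i, y i) / (16 * θ ^ 2) + 2 * R := by field_simp; ring
  rw [this]
  linarith

theorem bernoulli_sum_abs_tail {Ω ι : Type*} [MeasurableSpace Ω] {μ : Measure Ω}
    [IsProbabilityMeasure μ] [Fintype ι] {E : ι → Ω → ℝ} {p θ R : ℝ} (hp0 : 0 ≤ p) (hp1 : p ≤ 1)
    (hθ : 0 < θ) (hE : ∀ i, Measurable (E i)) (h01 : ∀ i, ∀ᵐ ω ∂μ, E i ω = 0 ∨ E i ω = 1)
    (hp : ∀ i, μ.real {ω | E i ω = 1} = p) (hind : iIndepFun E μ) {y : ι → ℝ}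
    (hy0 : ∀ i, 0 ≤ y i) (hy1 : ∀ i, y i ≤ 4 * θ ^ 2) :
    μ.real {ω | p / 4 * ∑ i, y i + 32 * θ ^ 2 * R ≤ |∑ i, (E i ω - p) * y i|} ≤
      2 * Real.exp (-(2 * R)) := by
  have h1 := bernoulli_sum_tail (R := R) hp0 hp1 hθ hE h01 hp hind hy0 hy1 (τ := 1) (by simp)
  have h2 := bernoulli_sum_tail (R := R) hp0 hp1 hθ hE h01 hp hind hy0 hy1 (τ := -1) (by simp)
  simp only [one_mul, neg_mul] at h1 h2
  have hsub : {ω | p / 4 * ∑ i, y i + 32 * θ ^ 2 * R ≤ |∑ i, (E i ω - p) * y i|} ⊆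
      {ω | p / 4 * ∑ i, y i + 32 * θ ^ 2 * R ≤ ∑ i, (E i ω - p) * y i} ∪
      {ω | p / 4 * ∑ i, y i + 32 * θ ^ 2 * R ≤ -∑ i, (E i ω - p) * y i} :=
    fun ω h => by
      simp only [Set.mem_ofPred_eq, Set.mem_union] at h ⊢
      exact le_abs.1 h
  have h3 := (measureReal_mono hsub (μ := μ)).trans (measureReal_union_le _ _)
  linarith

/-- The set of positions at which a mask equals `1`. -/
noncomputable def observedSet {ι : Type*} [Fintype ι] (e : ι → ℝ) : Finset ι :=
  Finset.univ.filter fun i => e i = 1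

theorem measurableSet_observedSet_eq {ι : Type*} [Fintype ι] (S : Finset ι) :
    MeasurableSet {e : ι → ℝ | observedSet e = S} := by
  have : {e : ι → ℝ | observedSet e = S} = ⋂ i, {e | e i = 1 ↔ i ∈ S} := by
    ext e; simp [observedSet, Finset.ext_iff]
  rw [this]
  refine MeasurableSet.iInter fun i => ?_
  by_cases h : i ∈ S
  · simpa [h] using measurableSet_eq_fun (f := fun e : ι → ℝ => e i) (by fun_prop) measurable_const
  · simp only [h, iff_false]
    exact (measurableSet_eq_fun (f := fun e : ι → ℝ => e i) (by fun_prop) measurable_const).compl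

/-- Conditioning on the mask: if, for every value `S` of the observed set, the noise falls into
`Bad S` with probability at most `β`, then it falls into the set belonging to the random observed
set with probability at most `β`. -/
theorem measure_conditional_bad_le {Ω ι : Type*} [MeasurableSpace Ω] {μ : Measure Ω}
    [IsProbabilityMeasure μ] [Fintype ι] {E X : Ω → ι → ℝ} (hE : Measurable E) (hX : Measurable X)
    (hind : IndepFun E X μ) {Bad : Finset ι → Set (ι → ℝ)} (hB : ∀ S, MeasurableSet (Bad S))
    {β : ℝ} (hβ : ∀ S, μ.real (X ⁻¹' Bad S) ≤ β) :
    MeasurableSet {ω | X ω ∈ Bad (observedSet (E ω))} ∧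
      μ.real {ω | X ω ∈ Bad (observedSet (E ω))} ≤ β := by
  classical
  let A : Finset ι → Set Ω := fun S => E ⁻¹' {e | observedSet e = S}
  have hA : ∀ S, MeasurableSet (A S) := fun S => hE (measurableSet_observedSet_eq S)
  have heq : {ω | X ω ∈ Bad (observedSet (E ω))} = ⋃ S, A S ∩ X ⁻¹' Bad S := by
    ext ω; simp [A]
  have hsum : ∑ S, μ.real (A S) = 1 := by
    rw [← measureReal_iUnion_fintype _ hA]
    · rw [show ⋃ S, A S = Set.univ by ext ω; simp [A]]; simp
    · intro S T hST
      refine Set.disjoint_left.2 fun ω h1 h2 => hST ?_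
      simp only [A, Set.mem_preimage, Set.mem_ofPred_eq] at h1 h2
      rw [← h1, ← h2]
  rw [heq]
  refine ⟨MeasurableSet.iUnion fun S => (hA S).inter (hX (hB S)), ?_⟩
  refine (measureReal_iUnion_fintype_le _).trans ?_
  calc ∑ S, μ.real (A S ∩ X ⁻¹' Bad S) = ∑ S, μ.real (A S) * μ.real (X ⁻¹' Bad S) := by
        refine Finset.sum_congr rfl fun S _ => ?_
        have := hind.measure_inter_preimage_eq_mul _ _ (measurableSet_observedSet_eq S) (hB S)
        simp only [measureReal_def, A, this, ENNReal.toReal_mul]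
    _ ≤ ∑ S, μ.real (A S) * β := by
        gcongr with S; exact hβ S
    _ = β := by rw [← Finset.sum_mul, hsum, one_mul]

/-! ### Polynomial parametrizations of the factor classes -/

/-- The set `T` of matrices lies in the image of a polynomial map of degree at most `3` in at most
`D` real parameters. -/
def PolyParam {n m : ℕ} (D : ℕ) (T : Set (Matrix (Fin n) (Fin m) ℝ)) : Prop :=
  ∃ (P : Type) (_ : Fintype P) (Q : Fin n → Fin m → MvPolynomial P ℝ),
    Fintype.card P ≤ D ∧ (∀ i j, (Q i j).totalDegree ≤ 3) ∧
    ∀ θ ∈ T, ∃ w : P → ℝ, ∀ i j, θ i j = MvPolynomial.eval w (Q i j)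

theorem PolyParam.mono {n m D D' : ℕ} {T T' : Set (Matrix (Fin n) (Fin m) ℝ)}
    (h : PolyParam D T) (hT : T' ⊆ T) (hD : D ≤ D') : PolyParam D' T' := by
  obtain ⟨P, hP, Q, hc, hd, hw⟩ := h
  exact ⟨P, hP, Q, hc.trans hD, hd, fun θ hθ => hw θ (hT hθ)⟩

theorem PolyParam.transpose {n m D : ℕ} {T : Set (Matrix (Fin n) (Fin m) ℝ)}
    (h : PolyParam D T) : PolyParam D {θ : Matrix (Fin m) (Fin n) ℝ | θ.transpose ∈ T} := by
  obtain ⟨P, hP, Q, hc, hd, hw⟩ := h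
  refine ⟨P, hP, fun i j => Q j i, hc, fun i j => hd j i, fun θ hθ => ?_⟩
  obtain ⟨w, h⟩ := hw _ hθ
  exact ⟨w, fun i j => h j i⟩

theorem polyParam_univ (n m : ℕ) :
    PolyParam (n * m) (Set.univ : Set (Matrix (Fin n) (Fin m) ℝ)) := by
  refine ⟨Fin n × Fin m, inferInstance, fun i j => MvPolynomial.X (i, j), by simp, fun i j => ?_,
    fun θ _ => ⟨fun q => θ q.1 q.2, fun i j => by simp⟩⟩
  rw [MvPolynomial.totalDegree_X]; norm_num

/-- The entries of row `i` of `X` vanish outside the columns `f (i, l)`. Written as a sum over `l`,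
so that `f (i, ·)` need not be injective. -/
def HasSupportMap {n k s : ℕ} (f : Fin n × Fin s → Fin k) (X : Matrix (Fin n) (Fin k) ℝ) : Prop :=
  ∃ x : Fin n × Fin s → ℝ, ∀ i a, X i a = ∑ l, if f (i, l) = a then x (i, l) else 0

theorem totalDegree_ite_X_le {P : Type*} (c : Prop) [Decidable c] (v : P) :
    (if c then MvPolynomial.X v else 0 : MvPolynomial P ℝ).totalDegree ≤ 1 := by
  split_ifs
  · rw [MvPolynomial.totalDegree_X]
  · simp

theorem totalDegree_sum_ite_X_le {ι P : Type*} [Fintype ι] (c : ι → Prop) [DecidablePred c]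
    (v : ι → P) :
    (∑ l, if c l then MvPolynomial.X (v l) else 0 : MvPolynomial P ℝ).totalDegree ≤ 1 :=
  MvPolynomial.totalDegree_finsetSum_le fun _ _ => totalDegree_ite_X_le _ _

theorem polyParam_mul (n r m : ℕ) :
    PolyParam (n * r + r * m) {θ | ∃ (U : Matrix (Fin n) (Fin r) ℝ)
      (V : Matrix (Fin r) (Fin m) ℝ), θ = U * V} := by
  refine ⟨(Fin n × Fin r) ⊕ (Fin r × Fin m), inferInstance, fun i j => ∑ a,
    MvPolynomial.X (Sum.inl (i, a)) * MvPolynomial.X (Sum.inr (a, j)), by simp, fun i j => ?_, ?_⟩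
  · refine MvPolynomial.totalDegree_finsetSum_le fun a _ => ?_
    refine (MvPolynomial.totalDegree_mul _ _).trans ?_
    rw [MvPolynomial.totalDegree_X, MvPolynomial.totalDegree_X]; norm_num
  · rintro _ ⟨U, V, rfl⟩
    exact ⟨Sum.elim (fun q => U q.1 q.2) (fun q => V q.1 q.2), fun i j => by
      simp [Matrix.mul_apply]⟩

theorem polyParam_sparse_mul {n k s : ℕ} (m : ℕ) (f : Fin n × Fin s → Fin k) :
    PolyParam (n * s + k * m) {θ | ∃ (X : Matrix (Fin n) (Fin k) ℝ)
      (W : Matrix (Fin k) (Fin m) ℝ), HasSupportMap f X ∧ θ = X * W} := by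
  refine ⟨(Fin n × Fin s) ⊕ (Fin k × Fin m), inferInstance, fun i j => ∑ a,
    (∑ l, if f (i, l) = a then MvPolynomial.X (Sum.inl (i, l)) else 0) *
      MvPolynomial.X (Sum.inr (a, j)), by simp, fun i j => ?_, ?_⟩
  · refine MvPolynomial.totalDegree_finsetSum_le fun a _ => ?_
    refine (MvPolynomial.totalDegree_mul _ _).trans ?_
    rw [MvPolynomial.totalDegree_X]
    have := totalDegree_sum_ite_X_le (fun l => f (i, l) = a)
      (fun l => (Sum.inl (i, l) : (Fin n × Fin s) ⊕ (Fin k × Fin m)))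
    omega
  · rintro _ ⟨X, W, ⟨x, hx⟩, rfl⟩
    refine ⟨Sum.elim x (fun q => W q.1 q.2), fun i j => ?_⟩
    rw [Matrix.mul_apply, map_sum]
    refine Finset.sum_congr rfl fun a _ => ?_
    rw [map_mul, map_sum, hx, MvPolynomial.eval_X, Sum.elim_inr]
    congr 1
    refine Finset.sum_congr rfl fun l _ => ?_
    split_ifs <;> simp

theorem polyParam_sparse_mul_sparse {n m k k' s s' : ℕ} (f : Fin n × Fin s → Fin k)
    (g : Fin m × Fin s' → Fin k') :
    PolyParam (n * s + m * s' + k * k') {θ | ∃ (X : Matrix (Fin n) (Fin k) ℝ)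
      (B : Matrix (Fin k) (Fin k') ℝ) (Z : Matrix (Fin m) (Fin k') ℝ),
      HasSupportMap f X ∧ HasSupportMap g Z ∧ θ = X * B * Z.transpose} := by
  refine ⟨((Fin n × Fin s) ⊕ (Fin m × Fin s')) ⊕ (Fin k × Fin k'), inferInstance,
    fun i j => ∑ b, (∑ a,
      (∑ l, if f (i, l) = a then MvPolynomial.X (Sum.inl (Sum.inl (i, l))) else 0) *
      MvPolynomial.X (Sum.inr (a, b))) *
      (∑ l, if g (j, l) = b then MvPolynomial.X (Sum.inl (Sum.inr (j, l))) else 0),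
    by simp, fun i j => ?_, ?_⟩
  · refine MvPolynomial.totalDegree_finsetSum_le fun b _ => ?_
    refine (MvPolynomial.totalDegree_mul _ _).trans ?_
    have h1 := totalDegree_sum_ite_X_le (fun l => g (j, l) = b)
      (fun l => (Sum.inl (Sum.inr (j, l)) :
        ((Fin n × Fin s) ⊕ (Fin m × Fin s')) ⊕ (Fin k × Fin k')))
    refine (add_le_add (MvPolynomial.totalDegree_finsetSum_le (d := 2) fun a _ => ?_) h1).trans
      le_rfl
    refine (MvPolynomial.totalDegree_mul _ _).trans ?_
    rw [MvPolynomial.totalDegree_X]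
    have := totalDegree_sum_ite_X_le (fun l => f (i, l) = a)
      (fun l => (Sum.inl (Sum.inl (i, l)) :
        ((Fin n × Fin s) ⊕ (Fin m × Fin s')) ⊕ (Fin k × Fin k')))
    omega
  · rintro _ ⟨X, B, Z, ⟨x, hx⟩, ⟨z, hz⟩, rfl⟩
    refine ⟨Sum.elim (Sum.elim x z) (fun q => B q.1 q.2), fun i j => ?_⟩
    rw [Matrix.mul_apply, map_sum]
    refine Finset.sum_congr rfl fun b _ => ?_
    rw [map_mul, Matrix.mul_apply, map_sum, Matrix.transpose_apply, hz, map_sum]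
    congr 1
    · refine Finset.sum_congr rfl fun a _ => ?_
      rw [map_mul, map_sum, hx, MvPolynomial.eval_X, Sum.elim_inr]
      congr 1
      refine Finset.sum_congr rfl fun l _ => ?_
      split_ifs <;> simp
    · refine Finset.sum_congr rfl fun l _ => ?_
      split_ifs <;> simp

theorem exists_hasSupportMap {n k s : ℕ} (hk : 1 ≤ k) {X : Matrix (Fin n) (Fin k) ℝ}
    (hX : ∀ i, hammingNorm (X i) ≤ s) : ∃ f : Fin n × Fin s → Fin k, HasSupportMap f X := by
  classical
  have he : ∀ i, Nonempty ({a // X i a ≠ 0} ↪ Fin s) := fun i => by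
    refine Function.Embedding.nonempty_of_card_le ?_
    rw [Fintype.card_subtype, Fintype.card_fin]
    exact hX i
  let e := fun i => (he i).some
  refine ⟨fun q => Function.extend (e q.1) Subtype.val (fun _ => ⟨0, hk⟩) q.2,
    fun q => Function.extend (e q.1) (fun a => X q.1 a) (fun _ => 0) q.2, fun i a => ?_⟩
  have hzero : ∀ l ∉ Finset.univ.map (e i),
      Function.extend (e i) (fun a => X i a) (fun _ => 0) l = 0 := fun l hl =>
    Function.extend_apply' _ _ _ fun ⟨b, hb⟩ => hl (by simp [← hb])
  rw [← Finset.sum_subset (Finset.subset_univ (Finset.univ.map (e i)))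
    (fun l _ hl => by dsimp only; rw [hzero l hl, ite_self]), Finset.sum_map]
  simp only [(e i).injective.extend_apply]
  by_cases ha : X i a = 0
  · rw [ha]
    refine (Finset.sum_eq_zero fun b _ => ?_).symm
    rw [if_neg]
    rintro rfl
    exact b.2 ha
  · rw [Finset.sum_eq_single (⟨a, ha⟩ : {a // X i a ≠ 0})]
    · simp
    · intro b _ hb
      rw [if_neg fun h => hb (Subtype.ext h)]
    · simp

/-! ### Support patterns and their cost -/

/-- The combinatorial data recorded about a factor matrix: nothing (`none`), or a row sparsity,
stored as its predecessor `s`, together with the columns that may carry the non-zero entries. -/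
abbrev FactorPattern (n k : ℕ) : Type := Option (Σ s : Fin k, Fin n × Fin (s + 1) → Fin k)

/-- The matrix is compatible with the pattern. -/
def FactorPattern.Fits {n k : ℕ} : FactorPattern n k → Matrix (Fin n) (Fin k) ℝ → Prop
  | none, _ => True
  | some f, X => HasSupportMap f.2 X

/-- The number of parameters that a factor contributes: `n * r` if nothing is recorded, where `r`
is the rank bound coming from the other side, and one parameter for each possible non-zero entry
otherwise. -/
def FactorPattern.dim {n k : ℕ} (r : ℕ) : FactorPattern n k → ℕ
  | none => n * r
  | some f => n * (f.1 + 1)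

/-- The part of the complexity that pays for the pattern, with `μ = n ∧ m`. It bounds both the
logarithm of the number of patterns and a multiple of the number of parameters. -/
noncomputable def FactorPattern.cost {n k : ℕ} (r μ : ℕ) : FactorPattern n k → ℝ
  | none => n * r * Real.log (6 * √μ)
  | some f => n * (f.1 + 1 : ℕ) * Real.log (k * μ)

/-- The products `X B Zᵀ` whose outer factors have the given patterns. -/
def chartSet {n m kn km : ℕ} (jn : FactorPattern n kn) (jm : FactorPattern m km) :
    Set (Matrix (Fin n) (Fin m) ℝ) :=
  {θ | ∃ F : Factors n m kn km, jn.Fits F.X ∧ jm.Fits F.Z ∧ F.theta = θ}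

/-- The parameter count. If an inner dimension `kn` or `km` is larger than the corresponding outer
dimension `n` or `m`, the factor on that side is absorbed into `B`; a factor of unknown pattern is
absorbed as well. -/
theorem polyParam_chartSet {n m kn km : ℕ} (jn : FactorPattern n kn) (jm : FactorPattern m km) :
    PolyParam (jn.dim (min m km) + jm.dim (min n kn) + min n kn * min m km)
      (chartSet jn jm) := by
  have hall : ∀ D, n * m ≤ D → PolyParam D (chartSet jn jm) := fun D hD =>
    (polyParam_univ n m).mono (Set.subset_univ _) hD
  have hleft : ∀ (f : Σ s : Fin kn, Fin n × Fin (s + 1) → Fin kn) D, jn = some f →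
      n * (f.1 + 1) + kn * m ≤ D → PolyParam D (chartSet jn jm) := by
    rintro f D rfl hD
    refine (polyParam_sparse_mul m f.2).mono ?_ hD
    rintro _ ⟨F, h1, _, rfl⟩
    exact ⟨F.X, F.B * F.Z.transpose, h1, by rw [Factors.theta, Matrix.mul_assoc]⟩
  have hright : ∀ (g : Σ s : Fin km, Fin m × Fin (s + 1) → Fin km) D, jm = some g →
      m * (g.1 + 1) + km * n ≤ D → PolyParam D (chartSet jn jm) := by
    rintro g D rfl hD
    refine (polyParam_sparse_mul n g.2).transpose.mono ?_ hD
    rintro _ ⟨F, _, h2, rfl⟩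
    exact ⟨F.Z, (F.X * F.B).transpose, h2, by rw [Factors.theta, Matrix.transpose_mul,
      Matrix.transpose_transpose]⟩
  -- in each case, an inner dimension at least the outer one leaves only the trivial count `n m`, or
  -- the parametrization of the other side
  rcases jn with _ | f <;> rcases jm with _ | g <;> simp only [FactorPattern.dim]
  · rcases le_total n kn with h1 | h1
    · refine hall _ ?_
      rw [min_eq_left h1]; nlinarith [Nat.zero_le (n * min m km)]
    rcases le_total m km with h2 | h2
    · refine hall _ ?_
      rw [min_eq_left h2]; nlinarith [Nat.zero_le (m * min n kn)]
    rw [min_eq_right h1, min_eq_right h2]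
    rcases le_total kn km with h | h
    · refine (polyParam_mul n kn m).mono ?_ (by nlinarith)
      rintro _ ⟨F, _, _, rfl⟩
      exact ⟨F.X, F.B * F.Z.transpose, by rw [Factors.theta, Matrix.mul_assoc]⟩
    · refine (polyParam_mul n km m).mono ?_ (by nlinarith)
      rintro _ ⟨F, _, _, rfl⟩
      exact ⟨F.X * F.B, F.Z.transpose, rfl⟩
  · rcases le_total m km with h2 | h2
    · refine hall _ ?_
      rw [min_eq_left h2]; nlinarith [Nat.zero_le (m * (g.1 + 1) + min n kn * m)]
    · refine hright g _ rfl ?_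
      rw [min_eq_right h2]; nlinarith [Nat.zero_le (min n kn * km)]
  · rcases le_total n kn with h1 | h1
    · refine hall _ ?_
      rw [min_eq_left h1]; nlinarith [Nat.zero_le (n * (f.1 + 1) + n * min m km)]
    · refine hleft f _ rfl ?_
      rw [min_eq_right h1]; nlinarith [Nat.zero_le (kn * min m km)]
  · rcases le_total n kn with h1 | h1 <;> rcases le_total m km with h2 | h2
    · refine hall _ ?_
      rw [min_eq_left h1, min_eq_left h2]; nlinarith
    · refine hright g _ rfl ?_
      rw [min_eq_left h1, min_eq_right h2]; nlinarith
    · refine hleft f _ rfl ?_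
      rw [min_eq_right h1, min_eq_left h2]; nlinarith
    · rw [min_eq_right h1, min_eq_right h2]
      refine (polyParam_sparse_mul_sparse f.2 g.2).mono ?_ le_rfl
      rintro _ ⟨F, h1, h2, rfl⟩
      exact ⟨F.X, F.B, F.Z, h1, h2, rfl⟩

/-- A lower bound for the penalty that depends on the patterns only. -/
noncomputable def chartCost {n m kn km : ℕ} (jn : FactorPattern n kn) (jm : FactorPattern m km) :
    ℝ :=
  jn.cost (min m km) (min n m) + jm.cost (min n kn) (min n m) +
    ((min n kn : ℕ) : ℝ) * (min m km : ℕ) * Real.log (6 * √((min n m : ℕ) : ℝ))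

theorem exists_pattern_cost_le {n k s s' r μ : ℕ} (hk : 1 ≤ k) (hμ : 1 ≤ μ) (hs : 1 ≤ s)
    (hsk : s ≤ k) (hs' : 1 ≤ s') {X : Matrix (Fin n) (Fin k) ℝ} (hX : ∀ i, hammingNorm (X i) ≤ s) :
    ∃ j : FactorPattern n k, j.Fits X ∧
      j.cost r μ ≤ min ((n : ℝ) * r * Real.log (6 * √(μ : ℝ)))
        ((n : ℝ) * s * Real.log ((k : ℝ) * s' * μ)) := by
  rcases le_total ((n : ℝ) * r * Real.log (6 * √(μ : ℝ)))
    ((n : ℝ) * s * Real.log ((k : ℝ) * s' * μ)) with h | h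
  · exact ⟨none, trivial, by rw [min_eq_left h, FactorPattern.cost]⟩
  · obtain ⟨t, rfl⟩ : ∃ t, s = t + 1 := ⟨s - 1, by omega⟩
    obtain ⟨f, hf⟩ := exists_hasSupportMap hk hX
    refine ⟨some ⟨⟨t, hsk⟩, f⟩, hf, ?_⟩
    rw [min_eq_right h]
    simp only [FactorPattern.cost]
    have h1 : (1 : ℝ) ≤ k := by exact_mod_cast hk
    have h2 : (1 : ℝ) ≤ μ := by exact_mod_cast hμ
    have h3 : (1 : ℝ) ≤ s' := by exact_mod_cast hs'
    gcongr
    nlinarith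

/-- Every factorization is covered by a pair of patterns that its penalty pays for: on each side the
pattern is chosen according to which term realizes the minimum in the complexity. -/
theorem exists_chart {Dn Dm : Set ℝ} {n m kn km : ℕ} {Bmax θmx : ℝ} (hn : 1 ≤ n) (hm : 1 ≤ m)
    {F : Factors n m kn km} (hF : F ∈ factorUnion Dn Dm n m kn km Bmax θmx) :
    ∃ (jn : FactorPattern n kn) (jm : FactorPattern m km),
      F.theta ∈ chartSet jn jm ∧ chartCost jn jm ≤ penalty F := by
  obtain ⟨sn, hsn, sm, hsm, hX, -, hZ, -⟩ := hF
  rw [Finset.mem_Icc] at hsn hsm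
  have hrow : ∀ {n k : ℕ} (A : Matrix (Fin n) (Fin k) ℝ), 1 ≤ k → max 1 (rowSparsity A) ≤ k ∧
      ∀ i, hammingNorm (A i) ≤ max 1 (rowSparsity A) := fun {n k} A hk => by
    refine ⟨max_le hk (Finset.sup_le fun i _ => hammingNorm_le_card_fintype.trans (by simp)),
      fun i => le_max_of_le_right ?_⟩
    exact Finset.le_sup (f := fun i => hammingNorm (A i)) (Finset.mem_univ i)
  have hkn : 1 ≤ kn := hsn.1.trans hsn.2
  have hkm : 1 ≤ km := hsm.1.trans hsm.2
  obtain ⟨hX1, hX2⟩ := hrow F.X hkn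
  obtain ⟨hZ1, hZ2⟩ := hrow F.Z hkm
  have hμ : 1 ≤ min n m := le_min hn hm
  obtain ⟨jn, hjn, hcn⟩ := exists_pattern_cost_le (r := min m km) hkn hμ (le_max_left _ _) hX1
    (le_max_left 1 (rowSparsity F.Z)) hX2
  obtain ⟨jm, hjm, hcm⟩ := exists_pattern_cost_le (r := min n kn) hkm hμ (le_max_left _ _) hZ1
    (le_max_left 1 (rowSparsity F.X)) hZ2
  refine ⟨jn, jm, ⟨F, hjn, hjm, rfl⟩, ?_⟩
  have hpos : 0 < √((min n m : ℕ) : ℝ) := Real.sqrt_pos.2 (by exact_mod_cast hμ)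
  unfold chartCost penalty complexity
  gcongr
  norm_num

theorem exp_le_min_log {μ : ℕ} (hμ : Real.exp 400 ≤ μ) :
    400 ≤ Real.log μ ∧ 200 ≤ Real.log (6 * √(μ : ℝ)) := by
  have hpos : (0 : ℝ) < μ := (Real.exp_pos _).trans_le hμ
  have h1 : 400 ≤ Real.log μ := (Real.le_log_iff_exp_le hpos).2 hμ
  refine ⟨h1, ?_⟩
  have hs : 0 < √(μ : ℝ) := Real.sqrt_pos.2 hpos
  rw [Real.log_mul (by norm_num) hs.ne', Real.log_sqrt hpos.le]
  have : 0 ≤ Real.log 6 := Real.log_nonneg (by norm_num)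
  linarith

theorem pattern_dim_le_cost {n k r μ : ℕ} (hμ : Real.exp 400 ≤ μ) (j : FactorPattern n k) :
    200 * (j.dim r : ℝ) ≤ j.cost r μ := by
  obtain ⟨h1, h2⟩ := exp_le_min_log hμ
  have hpos : (0 : ℝ) < μ := (Real.exp_pos _).trans_le hμ
  rcases j with _ | ⟨s, f⟩
  · simp only [FactorPattern.dim, FactorPattern.cost]
    push_cast
    rw [mul_comm (200 : ℝ)]
    gcongr
  · simp only [FactorPattern.dim, FactorPattern.cost]
    have hk : (1 : ℝ) ≤ k := by exact_mod_cast s.pos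
    have h3 : 200 ≤ Real.log (k * μ) := by
      rw [Real.log_mul (by positivity) hpos.ne']
      linarith [Real.log_nonneg hk]
    push_cast
    rw [mul_comm (200 : ℝ)]
    gcongr

/-- Summing over all patterns: the cost of a sparse pattern exceeds the logarithm of the number
`k ^ (n s)` of support maps by a large multiple of `n`. -/
theorem sum_exp_pattern_cost_le {n k r μ : ℕ} (hμ : Real.exp 400 ≤ μ) (hn : 2 ≤ n) (hr : 1 ≤ r) :
    ∑ j : FactorPattern n k, Real.exp (-(17 / 10 * j.cost r μ)) ≤ 2 * Real.exp (-n) := by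
  obtain ⟨h1, h2⟩ := exp_le_min_log hμ
  have hpos : (0 : ℝ) < μ := (Real.exp_pos _).trans_le hμ
  have hn' : (2 : ℝ) ≤ n := by exact_mod_cast hn
  have hr' : (1 : ℝ) ≤ r := by exact_mod_cast hr
  rw [Fintype.sum_option, two_mul]
  refine add_le_add ?_ ?_
  · simp only [FactorPattern.cost]
    rw [Real.exp_le_exp, neg_le_neg_iff]
    have : (n : ℝ) * 1 * 200 ≤ n * r * Real.log (6 * √(μ : ℝ)) := by gcongr
    linarith
  · -- `k` sparsity levels, each of which contributes at most `exp (-n) / k`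
    rw [Fintype.sum_sigma]
    rcases Nat.eq_zero_or_pos k with rfl | hk
    · simp [(Real.exp_pos _).le]
    have hk' : (1 : ℝ) ≤ k := by exact_mod_cast hk
    have hlk : 0 ≤ Real.log k := Real.log_nonneg hk'
    calc ∑ s : Fin k, ∑ f : Fin n × Fin (s + 1) → Fin k,
          Real.exp (-(17 / 10 * FactorPattern.cost r μ (some ⟨s, f⟩)))
        ≤ ∑ s : Fin k, Real.exp (-n) / k := by
          refine Finset.sum_le_sum fun s _ => ?_
          simp only [FactorPattern.cost, Finset.sum_const, Finset.card_univ, Fintype.card_fun,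
            Fintype.card_prod, Fintype.card_fin, nsmul_eq_mul, Nat.cast_pow]
          rw [Real.log_mul (by positivity) hpos.ne']
          have hpow : (k : ℝ) ^ (n * (s.1 + 1)) = Real.exp ((n * (s.1 + 1) : ℕ) * Real.log k) := by
            rw [Real.exp_nat_mul, Real.exp_log (by linarith)]
          have hdiv : Real.exp (-n) / k = Real.exp (-n - Real.log k) := by
            rw [Real.exp_sub, Real.exp_log (by linarith)]
          rw [hpow, hdiv, ← Real.exp_add, Real.exp_le_exp]
          have hN : (n : ℝ) ≤ n * ((s.1 + 1 : ℕ) : ℝ) := by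
            push_cast
            nlinarith [(Nat.cast_nonneg s.1 : (0 : ℝ) ≤ s.1)]
          push_cast at hN ⊢
          have h3 : 2 * Real.log k ≤ (n : ℝ) * (s.1 + 1) * Real.log k :=
            mul_le_mul_of_nonneg_right (hn'.trans hN) hlk
          have h4 : (n : ℝ) * 400 ≤ (n : ℝ) * (s.1 + 1) * Real.log μ :=
            mul_le_mul hN h1 (by norm_num) (by positivity)
          linarith
      _ = Real.exp (-n) := by
          simp only [Finset.sum_const, Finset.card_univ, Fintype.card_fin, nsmul_eq_mul]
          field_simp

/-! ### Uniform deviation bounds -/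

/-- The norming points for the ratios `g a / den a`: a family of vectors that depends polynomially
on parameters, normalized by any function bounded below. -/
theorem exists_norming_ratio {α ι P : Type*} [Fintype ι] [Fintype P] {D : ℕ} (hD : 1 ≤ D)
    (hP : Fintype.card P ≤ D) {Q : ι → MvPolynomial P ℝ} (hQ : ∀ i, (Q i).totalDegree ≤ 6)
    {T : Set α} {g : α → ι → ℝ} {den : α → ℝ} {δ M : ℝ} (hδ : 0 < δ) (hden : ∀ a ∈ T, δ ≤ den a)
    (hM : ∀ a ∈ T, ∀ i, |g a i| ≤ M)
    (hg : ∀ a ∈ T, ∃ w : P → ℝ, ∀ i, g a i = MvPolynomial.eval w (Q i)) :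
    ∃ N : Finset α, (N : Set α) ⊆ T ∧ (N.card : ℝ) ≤ Real.exp (9 * D) ∧
      ∀ x : ι → ℝ, (∀ a ∈ N, |∑ i, x i * g a i| ≤ den a) → ∀ a ∈ T,
        |∑ i, x i * g a i| ≤ 15 / 14 * den a := by
  classical
  let F : α → ι → ℝ := fun a => (den a)⁻¹ • g a
  have hF : ∀ a (x : ι → ℝ), ∑ i, x i * F a i = (∑ i, x i * g a i) / den a := fun a x => by
    rw [Finset.sum_div]
    refine Finset.sum_congr rfl fun i _ => ?_
    simp only [F, Pi.smul_apply, smul_eq_mul]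
    ring
  have hpos : ∀ a ∈ T, 0 < den a := fun a ha => hδ.trans_le (hden a ha)
  obtain ⟨N, hNS, hN, h⟩ := exists_norming hD hP hQ (S := F '' T) (by
    rintro _ ⟨a, ha, rfl⟩
    obtain ⟨w, hw⟩ := hg a ha
    exact ⟨(den a)⁻¹, w, by ext i; simp [F, hw]⟩) (by
    refine isBounded_iff_forall_norm_le.2 ⟨δ⁻¹ * |M|, ?_⟩
    rintro _ ⟨a, ha, rfl⟩
    refine (pi_norm_le_iff_of_nonneg (by positivity)).2 fun i => ?_
    simp only [F, Pi.smul_apply, smul_eq_mul, norm_mul, norm_inv, Real.norm_eq_abs]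
    rw [abs_of_pos (hpos a ha)]
    have := hden a ha
    have := (hM a ha i).trans (le_abs_self M)
    gcongr)
  choose c hcT hc using fun v : N => hNS (Finset.mem_coe.2 v.2)
  refine ⟨N.attach.image c, ?_, ?_, fun x hx a ha => ?_⟩
  · intro a ha
    obtain ⟨v, hv, rfl⟩ := Finset.mem_image.1 (Finset.mem_coe.1 ha)
    exact hcT v
  · refine le_trans ?_ hN
    exact_mod_cast Finset.card_image_le.trans Finset.card_attach.le
  · have h1 := h x (fun v hv => by
      have hv' := hcT ⟨v, hv⟩
      have hcv : F (c ⟨v, hv⟩) = v := hc ⟨v, hv⟩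
      rw [← hcv, hF, abs_div, abs_of_pos (hpos _ hv'), div_le_one (hpos _ hv')]
      exact hx _ (Finset.mem_image_of_mem c (Finset.mem_attach _ _))) (F a)
      (Set.mem_image_of_mem F ha)
    rw [hF, abs_div, abs_of_pos (hpos a ha), div_le_iff₀ (hpos a ha)] at h1
    exact h1

/-- The union bound over the norming points costs only a small part of the exponent, as the number
of parameters is small compared with `R`. -/
theorem exp_union_bound {D : ℕ} {R c N : ℝ} (hD : 200 * (D : ℝ) ≤ R) (hc : 7 / 4 ≤ c)
    (hN : N ≤ Real.exp (9 * D)) :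
    N * (2 * Real.exp (-(c * R))) ≤ 2 * Real.exp (-(17 / 10 * R)) := by
  have hD0 : (0 : ℝ) ≤ D := Nat.cast_nonneg D
  have hR : 0 ≤ R := by linarith
  calc N * (2 * Real.exp (-(c * R))) ≤ Real.exp (9 * D) * (2 * Real.exp (-(c * R))) := by gcongr
    _ = 2 * Real.exp (9 * D + -(c * R)) := by rw [Real.exp_add]; ring
    _ ≤ _ := by
      gcongr
      nlinarith

/-- Uniform deviations of the noise over a polynomially parametrized set, for a fixed set `S` of
observed positions. -/
theorem chart_noise_bound {n m D : ℕ} {T : Set (Matrix (Fin n) (Fin m) ℝ)} (hT : PolyParam D T)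
    (hD1 : 1 ≤ D) {R θmx σ ς : ℝ} (hD : 200 * (D : ℝ) ≤ R) (hσ : 0 < σ) (hς : σ ≤ ς)
    (θ₀ : Matrix (Fin n) (Fin m) ℝ) (S : Finset (Fin n × Fin m))
    {Ω : Type*} [MeasurableSpace Ω] {μ : Measure Ω} [IsProbabilityMeasure μ]
    {X : Fin n × Fin m → Ω → ℝ} (hind : iIndepFun X μ)
    (hsub : ∀ i, HasSubgaussianMGF (X i) (Real.toNNReal (σ ^ 2)) μ) :
    ∃ Bad : Set (Fin n × Fin m → ℝ), MeasurableSet Bad ∧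
      μ.real {ω | (fun i => X i ω) ∈ Bad} ≤ 2 * Real.exp (-(17 / 10 * R)) ∧
      ∀ x ∉ Bad, ∀ θ ∈ T, (∀ i j, |θ i j| ≤ θmx) →
        |2 * ∑ q ∈ S, (θ q.1 q.2 - θ₀ q.1 q.2) * x q| ≤
          15 / 14 * (1 / 2 * ∑ q ∈ S, (θ q.1 q.2 - θ₀ q.1 q.2) ^ 2 + 7 * ς ^ 2 * R) := by
  classical
  obtain ⟨P, _, Q, hP, hQ, hw⟩ := hT
  have hD1' : (1 : ℝ) ≤ D := by exact_mod_cast hD1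
  have hR : 0 < R := by linarith
  have hς0 : 0 < ς := hσ.trans_le hς
  let T' : Set (Matrix (Fin n) (Fin m) ℝ) := {θ | θ ∈ T ∧ ∀ i j, |θ i j| ≤ θmx}
  let den : Matrix (Fin n) (Fin m) ℝ → ℝ := fun θ =>
    1 / 2 * ∑ q ∈ S, (θ q.1 q.2 - θ₀ q.1 q.2) ^ 2 + 7 * ς ^ 2 * R
  obtain ⟨N, hNT, hN, h⟩ := exists_norming_ratio (T := T') (den := den) (δ := 7 * ς ^ 2 * R)
    (g := fun θ q => θ q.1 q.2 - θ₀ q.1 q.2)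
    (M := θmx + ∑ q : Fin n × Fin m, |θ₀ q.1 q.2|)
    (Q := fun q => Q q.1 q.2 - MvPolynomial.C (θ₀ q.1 q.2)) hD1 hP
    (fun q => (MvPolynomial.totalDegree_sub_C_le _ _).trans ((hQ _ _).trans (by norm_num)))
    (by positivity)
    (fun θ _ => le_add_of_nonneg_left (mul_nonneg (by norm_num)
      (Finset.sum_nonneg fun _ _ => sq_nonneg _)))
    (fun θ hθ q => (abs_sub _ _).trans (add_le_add (hθ.2 _ _)
      (Finset.single_le_sum (f := fun q : Fin n × Fin m => |θ₀ q.1 q.2|)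
        (fun _ _ => abs_nonneg _) (Finset.mem_univ q))))
    (fun θ hθ => by
      obtain ⟨w, hw⟩ := hw θ hθ.1
      exact ⟨w, fun q => by simp [hw]⟩)
  have hsum : ∀ (x : Fin n × Fin m → ℝ) (θ : Matrix (Fin n) (Fin m) ℝ),
      ∑ q, (if q ∈ S then 2 * x q else 0) * (θ q.1 q.2 - θ₀ q.1 q.2) =
        2 * ∑ q ∈ S, (θ q.1 q.2 - θ₀ q.1 q.2) * x q := fun x θ => by
    simp only [ite_mul, zero_mul, Finset.sum_ite_mem, Finset.univ_inter, Finset.mul_sum]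
    exact Finset.sum_congr rfl fun q _ => by ring
  refine ⟨⋃ θ ∈ N, {x | den θ ≤ |2 * ∑ q ∈ S, (θ q.1 q.2 - θ₀ q.1 q.2) * x q|}, ?_, ?_, ?_⟩
  · refine Finset.measurableSet_biUnion _ fun θ _ => ?_
    exact measurableSet_le measurable_const (by fun_prop)
  · have hU : {ω | (fun i => X i ω) ∈ ⋃ θ ∈ N,
        {x | den θ ≤ |2 * ∑ q ∈ S, (θ q.1 q.2 - θ₀ q.1 q.2) * x q|}} =
        ⋃ θ ∈ N, {ω | den θ ≤ |2 * ∑ q ∈ S, (θ q.1 q.2 - θ₀ q.1 q.2) * X q ω|} := by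
      ext ω; simp
    rw [hU]
    refine (measureReal_biUnion_finset_le _ _).trans ?_
    calc _ ≤ ∑ θ ∈ N, 2 * Real.exp (-(7 / 4 * R)) := Finset.sum_le_sum fun θ _ => by
            have := subgaussian_sum_abs_tail hσ hς hR hind hsub
              (fun q => if q ∈ S then θ q.1 q.2 - θ₀ q.1 q.2 else 0)
            simpa [den, ite_pow, ite_mul, Finset.sum_ite_mem] using this
      _ = N.card * (2 * Real.exp (-(7 / 4 * R))) := by rw [Finset.sum_const, nsmul_eq_mul]
      _ ≤ _ := exp_union_bound hD le_rfl hN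
  · intro x hx θ hθ hb
    simp only [Set.mem_iUnion, Set.mem_ofPred_eq, not_exists, not_le] at hx
    have := h (fun q => if q ∈ S then 2 * x q else 0) (fun a ha => by
      rw [hsum]; exact (hx a ha).le) θ ⟨hθ, hb⟩
    rwa [hsum] at this

/-- Restricted isometry: uniform deviations of `‖(θ - θs)_Ω‖²` from `p ‖θ - θs‖²` over a
polynomially parametrized set. -/
theorem chart_mask_bound {n m D : ℕ} {T : Set (Matrix (Fin n) (Fin m) ℝ)} (hT : PolyParam D T)
    (hD1 : 1 ≤ D) {R θmx p : ℝ} (hD : 200 * (D : ℝ) ≤ R) (hθ : 0 < θmx) (hp0 : 0 ≤ p)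
    (hp1 : p ≤ 1) {θs : Matrix (Fin n) (Fin m) ℝ} (hθs : ∀ i j, |θs i j| ≤ θmx)
    {Ω : Type*} [MeasurableSpace Ω] {μ : Measure Ω} [IsProbabilityMeasure μ]
    {E : Fin n × Fin m → Ω → ℝ} (hE : ∀ i, Measurable (E i))
    (h01 : ∀ i, ∀ᵐ ω ∂μ, E i ω = 0 ∨ E i ω = 1)
    (hp : ∀ i, μ.real {ω | E i ω = 1} = p) (hind : iIndepFun E μ) :
    ∃ Bad : Set Ω, MeasurableSet Bad ∧ μ.real Bad ≤ 2 * Real.exp (-(17 / 10 * R)) ∧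
      ∀ ω ∉ Bad, ∀ θ ∈ T, (∀ i j, |θ i j| ≤ θmx) →
        |∑ q, (E q ω - p) * (θ q.1 q.2 - θs q.1 q.2) ^ 2| ≤
          15 / 14 * (p / 4 * ∑ q : Fin n × Fin m, (θ q.1 q.2 - θs q.1 q.2) ^ 2 +
            32 * θmx ^ 2 * R) := by
  classical
  obtain ⟨P, _, Q, hP, hQ, hw⟩ := hT
  have hD1' : (1 : ℝ) ≤ D := by exact_mod_cast hD1
  have hR : 0 < R := by linarith
  let T' : Set (Matrix (Fin n) (Fin m) ℝ) := {θ | θ ∈ T ∧ ∀ i j, |θ i j| ≤ θmx}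
  have hsq : ∀ θ ∈ T', ∀ q : Fin n × Fin m, (θ q.1 q.2 - θs q.1 q.2) ^ 2 ≤ 4 * θmx ^ 2 :=
    fun θ hθ q => by
      have h := (abs_sub (θ q.1 q.2) (θs q.1 q.2)).trans (add_le_add (hθ.2 q.1 q.2) (hθs q.1 q.2))
      rw [← sq_abs]
      nlinarith [abs_nonneg (θ q.1 q.2 - θs q.1 q.2)]
  let den : Matrix (Fin n) (Fin m) ℝ → ℝ := fun θ =>
    p / 4 * ∑ q : Fin n × Fin m, (θ q.1 q.2 - θs q.1 q.2) ^ 2 + 32 * θmx ^ 2 * R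
  obtain ⟨N, hNT, hN, h⟩ := exists_norming_ratio (T := T') (den := den) (δ := 32 * θmx ^ 2 * R)
    (g := fun θ (q : Fin n × Fin m) => (θ q.1 q.2 - θs q.1 q.2) ^ 2)
    (M := 4 * θmx ^ 2)
    (Q := fun q => (Q q.1 q.2 - MvPolynomial.C (θs q.1 q.2)) ^ 2) hD1 hP
    (fun q => (MvPolynomial.totalDegree_pow _ _).trans (by
      have := (MvPolynomial.totalDegree_sub_C_le (Q q.1 q.2) (θs q.1 q.2)).trans (hQ q.1 q.2)
      omega))
    (by positivity)
    (fun θ _ => le_add_of_nonneg_left (mul_nonneg (by positivity)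
      (Finset.sum_nonneg fun _ _ => sq_nonneg _)))
    (fun θ hθ q => by rw [abs_of_nonneg (sq_nonneg _)]; exact hsq θ hθ q)
    (fun θ hθ => by
      obtain ⟨w, hw⟩ := hw θ hθ.1
      exact ⟨w, fun q => by simp [hw]⟩)
  refine ⟨⋃ θ ∈ N, {ω | den θ ≤ |∑ q, (E q ω - p) * (θ q.1 q.2 - θs q.1 q.2) ^ 2|}, ?_, ?_, ?_⟩
  · refine Finset.measurableSet_biUnion _ fun θ _ => ?_
    exact measurableSet_le measurable_const (by fun_prop)
  · refine (measureReal_biUnion_finset_le _ _).trans ?_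
    calc _ ≤ ∑ θ ∈ N, 2 * Real.exp (-(2 * R)) := Finset.sum_le_sum fun θ hθN =>
            bernoulli_sum_abs_tail hp0 hp1 hθ hE h01 hp hind
              (y := fun q => (θ q.1 q.2 - θs q.1 q.2) ^ 2) (fun q => sq_nonneg _)
              (hsq θ (hNT (Finset.mem_coe.2 hθN)))
      _ = N.card * (2 * Real.exp (-(2 * R))) := by rw [Finset.sum_const, nsmul_eq_mul]
      _ ≤ _ := exp_union_bound hD (by norm_num) hN
  · intro ω hω θ hθ hb
    simp only [Set.mem_iUnion, Set.mem_ofPred_eq, not_exists, not_le] at hω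
    exact h (fun q => E q ω - p) (fun a ha => (hω a ha).le) θ ⟨hθ, hb⟩

/-- The number of parameters of a pair of patterns. -/
def chartDim {n m kn km : ℕ} (jn : FactorPattern n kn) (jm : FactorPattern m km) : ℕ :=
  jn.dim (min m km) + jm.dim (min n kn) + min n kn * min m km

theorem chartDim_le_chartCost {n m kn km : ℕ} (hμ : Real.exp 400 ≤ (min n m : ℕ))
    (jn : FactorPattern n kn) (jm : FactorPattern m km) :
    200 * (chartDim jn jm : ℝ) ≤ chartCost jn jm := by
  have h1 := pattern_dim_le_cost (r := min m km) hμ jn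
  have h2 := pattern_dim_le_cost (r := min n kn) hμ jm
  have h3 : ((min n kn : ℕ) : ℝ) * (min m km : ℕ) * 200 ≤
      ((min n kn : ℕ) : ℝ) * (min m km : ℕ) * Real.log (6 * √((min n m : ℕ) : ℝ)) := by
    have := (exp_le_min_log hμ).2
    gcongr
  unfold chartDim chartCost
  rw [Nat.cast_add, Nat.cast_add, Nat.cast_mul (min n kn)]
  linarith

theorem sum_exp_chartCost_le {n m kn km : ℕ} (hn : 2 ≤ n) (hm : 2 ≤ m) (hkn : 1 ≤ kn)
    (hkm : 1 ≤ km) (hμ : Real.exp 400 ≤ (min n m : ℕ)) :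
    ∑ c : FactorPattern n kn × FactorPattern m km,
      2 * Real.exp (-(17 / 10 * chartCost c.1 c.2)) ≤ 8 * Real.exp (-((n : ℝ) + m)) := by
  have h1 := sum_exp_pattern_cost_le (k := kn) (r := min m km) hμ hn (le_min (by omega) hkm)
  have h2 := sum_exp_pattern_cost_le (k := km) (r := min n kn) hμ hm (le_min (by omega) hkn)
  have h3 : 0 ≤ ((min n kn : ℕ) : ℝ) * (min m km : ℕ) *
      Real.log (6 * √((min n m : ℕ) : ℝ)) := by
    have := (exp_le_min_log hμ).2
    positivity
  calc ∑ c : FactorPattern n kn × FactorPattern m km,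
        2 * Real.exp (-(17 / 10 * chartCost c.1 c.2))
      ≤ ∑ c : FactorPattern n kn × FactorPattern m km,
        2 * (Real.exp (-(17 / 10 * c.1.cost (min m km) (min n m))) *
          Real.exp (-(17 / 10 * c.2.cost (min n kn) (min n m)))) := by
        refine Finset.sum_le_sum fun c _ => ?_
        rw [← Real.exp_add]
        unfold chartCost
        gcongr
        linarith
    _ = 2 * ((∑ j : FactorPattern n kn, Real.exp (-(17 / 10 * j.cost (min m km) (min n m)))) *
          ∑ j : FactorPattern m km, Real.exp (-(17 / 10 * j.cost (min n kn) (min n m)))) := by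
        rw [← Finset.mul_sum, Finset.sum_mul_sum, Fintype.sum_prod_type]
    _ ≤ 2 * ((2 * Real.exp (-(n : ℝ))) * (2 * Real.exp (-(m : ℝ)))) := by
        gcongr
    _ = 8 * Real.exp (-((n : ℝ) + m)) := by rw [neg_add, Real.exp_add]; ring

/-! ### The oracle inequality -/

theorem half_add_le_penalty {n m kn km : ℕ} (hn : 2 ≤ n) (hm : 2 ≤ m) (hkn : 1 ≤ kn)
    (hkm : 1 ≤ km) (F : Factors n m kn km) : ((n : ℝ) + m) / 2 ≤ penalty F := by
  have hμ : (2 : ℝ) ≤ ((min n m : ℕ) : ℝ) := by exact_mod_cast le_min hn hm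
  have hs : 1 ≤ √((min n m : ℕ) : ℝ) := Real.one_le_sqrt.2 (by linarith)
  have hlog2 : (1 / 2 : ℝ) ≤ Real.log 2 := by linarith [Real.log_two_gt_d9]
  have key : ∀ (N r k s s' : ℕ), 1 ≤ r → 1 ≤ k → 1 ≤ s → 1 ≤ s' → (N : ℝ) / 2 ≤
      min ((N : ℝ) * r * Real.log (6 * √((min n m : ℕ) : ℝ)))
        ((N : ℝ) * s * Real.log ((k : ℝ) * s' * (min n m : ℕ))) := by
    intro N r k s s' hr hk hs1 hs'
    have hr' : (1 : ℝ) ≤ r := by exact_mod_cast hr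
    have hk' : (1 : ℝ) ≤ k := by exact_mod_cast hk
    have hs1' : (1 : ℝ) ≤ s := by exact_mod_cast hs1
    have hs'' : (1 : ℝ) ≤ s' := by exact_mod_cast hs'
    have hl1 : (1 / 2 : ℝ) ≤ Real.log (6 * √((min n m : ℕ) : ℝ)) :=
      hlog2.trans (Real.log_le_log (by norm_num) (by linarith))
    have hl2 : (1 / 2 : ℝ) ≤ Real.log ((k : ℝ) * s' * (min n m : ℕ)) :=
      hlog2.trans (Real.log_le_log (by norm_num) 
        (by nlinarith [one_le_mul_of_one_le_of_one_le hk' hs'']))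
    refine le_min ?_ ?_
    · calc (N : ℝ) / 2 = N * 1 * (1 / 2) := by ring
        _ ≤ _ := by gcongr
    · calc (N : ℝ) / 2 = N * 1 * (1 / 2) := by ring
        _ ≤ _ := by gcongr
  have h1 := key n (min m km) kn _ _ (le_min (by omega) hkm) hkn
    (le_max_left 1 (rowSparsity F.X)) (le_max_left 1 (rowSparsity F.Z))
  have h2 := key m (min n kn) km _ _ (le_min (by omega) hkn) hkm
    (le_max_left 1 (rowSparsity F.Z)) (le_max_left 1 (rowSparsity F.X))
  have h3 : 0 ≤ ((min n kn : ℕ) : ℝ) * (min m km : ℕ) *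
      Real.log (9 * √((min n m : ℕ) : ℝ)) := by
    have : 0 ≤ Real.log (9 * √((min n m : ℕ) : ℝ)) := Real.log_nonneg (by linarith)
    positivity
  unfold penalty complexity
  linarith

theorem frobSq_eq_sum_prod {n m : ℕ} (A : Matrix (Fin n) (Fin m) ℝ) :
    frobSq A = ∑ q : Fin n × Fin m, A q.1 q.2 ^ 2 := by
  rw [frobSq, Fintype.sum_prod_type]

/-- The residual only involves the observed positions. -/
theorem frobSq_residual {n m : ℕ} {e : Fin n → Fin m → ℝ} (he : ∀ i j, e i j = 0 ∨ e i j = 1)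
    (x : Fin n → Fin m → ℝ) (θs θ : Matrix (Fin n) (Fin m) ℝ) :
    frobSq (observed e x θs - restrictObs e θ) =
      ∑ q ∈ observedSet fun q : Fin n × Fin m => e q.1 q.2,
        (θs q.1 q.2 + x q.1 q.2 - θ q.1 q.2) ^ 2 := by
  rw [frobSq_eq_sum_prod, observedSet, Finset.sum_filter]
  refine Finset.sum_congr rfl fun q _ => ?_
  rcases he q.1 q.2 with h | h <;> simp [observed, restrictObs, h]

theorem sum_mask_sub_mul {ι : Type*} [Fintype ι] {e : ι → ℝ} (he : ∀ i, e i = 0 ∨ e i = 1)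
    (p : ℝ) (y : ι → ℝ) :
    ∑ i, (e i - p) * y i = ∑ i ∈ observedSet e, y i - p * ∑ i, y i := by
  rw [observedSet, Finset.sum_filter, Finset.mul_sum, ← Finset.sum_sub_distrib]
  refine Finset.sum_congr rfl fun i _ => ?_
  rcases he i with h | h <;> simp [h]; ring

/-- The deterministic part of the argument: `a = θhat - θs` and `b = θ₀ - θs` are the errors of the
estimator and of the oracle, `x` is the noise, `S` the set of observed positions, `R` and `R₀` the
two penalties. The noise term uses up less than `8 ς ^ 2 R`, and what is left of the penalty pays
for the restricted isometry. -/
theorem oracle_bound_of_deviation_bounds {ι : Type*} [Fintype ι] (S : Finset ι) (a b x : ι → ℝ)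
    {p ς θ R Rc R₀ : ℝ} (hθ0 : 0 < θ) (hθ : θ ≤ ς) (hp : 0 ≤ p) (hR₀ : 0 ≤ R₀) (hRc0 : 0 ≤ Rc)
    (hRc : Rc ≤ R)
    (hcrit : ∑ i ∈ S, (x i - a i) ^ 2 + 8 * ς ^ 2 * R ≤
      ∑ i ∈ S, (x i - b i) ^ 2 + 8 * ς ^ 2 * R₀)
    (hnoise : |2 * ∑ i ∈ S, (a i - b i) * x i| ≤
      15 / 14 * (1 / 2 * ∑ i ∈ S, (a i - b i) ^ 2 + 7 * ς ^ 2 * Rc))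
    (hmask : |∑ i ∈ S, a i ^ 2 - p * ∑ i, a i ^ 2| ≤
      15 / 14 * (p / 4 * ∑ i, a i ^ 2 + 32 * θ ^ 2 * Rc))
    (hmask₀ : |∑ i ∈ S, b i ^ 2 - p * ∑ i, b i ^ 2| ≤ p / 4 * ∑ i, b i ^ 2 + 32 * θ ^ 2 * R₀) :
    p * ∑ i, a i ^ 2 ≤ 10000 * (p * ∑ i, b i ^ 2 + ς ^ 2 * R₀) := by
  have e1 : ∑ i ∈ S, (x i - a i) ^ 2 - ∑ i ∈ S, (x i - b i) ^ 2 =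
      ∑ i ∈ S, a i ^ 2 - ∑ i ∈ S, b i ^ 2 - 2 * ∑ i ∈ S, (a i - b i) * x i := by
    rw [Finset.mul_sum, ← Finset.sum_sub_distrib, ← Finset.sum_sub_distrib,
      ← Finset.sum_sub_distrib]
    exact Finset.sum_congr rfl fun i _ => by ring
  have e2 : ∑ i ∈ S, (a i - b i) ^ 2 ≤ 3 / 2 * ∑ i ∈ S, a i ^ 2 + 3 * ∑ i ∈ S, b i ^ 2 := by
    rw [Finset.mul_sum, Finset.mul_sum, ← Finset.sum_add_distrib]
    exact Finset.sum_le_sum fun i _ => by nlinarith [sq_nonneg (a i + 2 * b i)]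
  have h0 : 0 ≤ ∑ i ∈ S, a i ^ 2 := Finset.sum_nonneg fun i _ => sq_nonneg _
  have hb0 : 0 ≤ p * ∑ i, b i ^ 2 := mul_nonneg hp (Finset.sum_nonneg fun i _ => sq_nonneg _)
  have hsq : θ ^ 2 ≤ ς ^ 2 := by gcongr
  have r1 : ς ^ 2 * Rc ≤ ς ^ 2 * R := by gcongr
  have r2 : θ ^ 2 * Rc ≤ ς ^ 2 * R := (mul_le_mul_of_nonneg_right hsq hRc0).trans r1
  have r3 : θ ^ 2 * R₀ ≤ ς ^ 2 * R₀ := by gcongr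
  have r4 : 0 ≤ ς ^ 2 * R₀ := by positivity
  have n1 := (abs_le.1 hnoise).2
  have n2 := (abs_le.1 hmask).1
  have n3 := (abs_le.1 hmask₀).2
  linarith

/-- The oracle inequality against a fixed competitor `F₀`, outside an event of small probability,
when `n ∧ m` is large. -/
theorem exists_good_event {Dn Dm : Set ℝ} {n m kn km : ℕ} {Bmax θmx σ p : ℝ} (hn : 2 ≤ n)
    (hm : 2 ≤ m) (hd : 10 ≤ n + m) (hkn : 1 ≤ kn) (hkm : 1 ≤ km)
    (hμ : Real.exp 400 ≤ (min n m : ℕ)) (hθ : 0 < θmx) (hσ : 0 < σ) (hp0 : 0 < p) (hp1 : p ≤ 1)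
    {θs : Matrix (Fin n) (Fin m) ℝ} (hθs : ∀ i j, |θs i j| ≤ θmx)
    {Ω : Type*} [MeasurableSpace Ω] {μ : Measure Ω} [IsProbabilityMeasure μ]
    {E ξ : Fin n → Fin m → Ω → ℝ} (hmod : IsCompletionModel μ p σ E ξ)
    {F₀ : Factors n m kn km} (hF₀ : F₀ ∈ factorUnion Dn Dm n m kn km Bmax θmx) :
    ∃ Bad : Set Ω, MeasurableSet Bad ∧ μ.real Bad ≤ 5 * Real.exp (-((n : ℝ) + m) / 10) ∧
      ∀ ω ∉ Bad, (∀ i j, E i j ω = 0 ∨ E i j ω = 1) →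
      ∀ F ∈ factorUnion Dn Dm n m kn km Bmax θmx,
        criterion (8 * (max σ θmx) ^ 2) (fun i j => E i j ω)
          (observed (fun i j => E i j ω) (fun i j => ξ i j ω) θs) F ≤
        criterion (8 * (max σ θmx) ^ 2) (fun i j => E i j ω)
          (observed (fun i j => E i j ω) (fun i j => ξ i j ω) θs) F₀ →
        p * frobSq (F.theta - θs) ≤
          10000 * (p * frobSq (F₀.theta - θs) + (max σ θmx) ^ 2 * penalty F₀) := by
  classical
  set ς := max σ θmx
  let E' : Fin n × Fin m → Ω → ℝ := fun q => E q.1 q.2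
  let X' : Fin n × Fin m → Ω → ℝ := fun q => ξ q.1 q.2
  have hE' : ∀ q, Measurable (E' q) := fun q => hmod.measurable_mask _ _
  have hX' : ∀ q, Measurable (X' q) := fun q => hmod.measurable_noise _ _
  have hbd : ∀ F ∈ factorUnion Dn Dm n m kn km Bmax θmx, ∀ i j, |F.theta i j| ≤ θmx := by
    rintro F ⟨sn, -, sm, -, -, -, -, h⟩
    exact h
  let J := FactorPattern n kn × FactorPattern m km
  have hparam : ∀ c : J, PolyParam (chartDim c.1 c.2) (chartSet c.1 c.2) := fun c =>
    polyParam_chartSet c.1 c.2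
  have hdim1 : ∀ c : J, 1 ≤ chartDim c.1 c.2 := fun c => by
    have : 1 * 1 ≤ min n kn * min m km :=
      Nat.mul_le_mul (le_min (by omega) hkn) (le_min (by omega) hkm)
    unfold chartDim
    omega
  have hcost : ∀ c : J, 200 * (chartDim c.1 c.2 : ℝ) ≤ chartCost c.1 c.2 := fun c =>
    chartDim_le_chartCost hμ c.1 c.2
  have hcost0 : ∀ c : J, 0 ≤ chartCost c.1 c.2 := fun c =>
    le_trans (by positivity) (hcost c)
  have hsum := sum_exp_chartCost_le hn hm hkn hkm hμ
  -- deviations of the noise, for each set of observed positions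
  choose NB hNBm hNBp hNB using fun (S : Finset (Fin n × Fin m)) (c : J) =>
    chart_noise_bound (hparam c) (hdim1 c) (θmx := θmx) (hcost c) hσ (le_max_left σ θmx) F₀.theta S
      (X := X') hmod.noise_indep (fun q => hmod.noise_subgaussian _ _)
  obtain ⟨hnm, hnp⟩ := measure_conditional_bad_le (E := fun ω q => E' q ω)
    (X := fun ω q => X' q ω) (measurable_pi_iff.2 hE') (measurable_pi_iff.2 hX')
    hmod.mask_noise_indep (Bad := fun S => ⋃ c, NB S c)
    (fun S => MeasurableSet.iUnion fun c => hNBm S c) (β := 8 * Real.exp (-((n : ℝ) + m)))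
    (fun S => by
      rw [Set.preimage_iUnion]
      exact (measureReal_iUnion_fintype_le _).trans
        ((Finset.sum_le_sum fun c _ => hNBp S c).trans hsum))
  -- deviations of the mask
  choose MB hMBm hMBp hMB using fun c : J =>
    chart_mask_bound (hparam c) (hdim1 c) (hcost c) hθ hp0.le hp1 hθs hE'
      (fun q => hmod.mask_zero_one _ _) (fun q => hmod.mask_prob _ _) hmod.mask_indep
  have hMU : μ.real (⋃ c, MB c) ≤ 8 * Real.exp (-((n : ℝ) + m)) :=
    (measureReal_iUnion_fintype_le _).trans ((Finset.sum_le_sum fun c _ => hMBp c).trans hsum)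
  -- deviation of the mask for the fixed competitor, with its own penalty as complexity
  have hpen := half_add_le_penalty hn hm hkn hkm F₀
  have hO := bernoulli_sum_abs_tail (R := penalty F₀) hp0.le hp1 hθ hE'
    (fun q => hmod.mask_zero_one _ _) (fun q => hmod.mask_prob _ _) hmod.mask_indep
    (y := fun q => (F₀.theta q.1 q.2 - θs q.1 q.2) ^ 2) (fun q => sq_nonneg _) (fun q => by
      have h := (abs_sub (F₀.theta q.1 q.2) (θs q.1 q.2)).trans
        (add_le_add (hbd F₀ hF₀ q.1 q.2) (hθs q.1 q.2))
      rw [← sq_abs]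
      nlinarith [abs_nonneg (F₀.theta q.1 q.2 - θs q.1 q.2)])
  refine ⟨_, (hnm.union (MeasurableSet.iUnion hMBm)).union
    (measurableSet_le (f := fun _ => p / 4 * ∑ q : Fin n × Fin m,
        (F₀.theta q.1 q.2 - θs q.1 q.2) ^ 2 + 32 * θmx ^ 2 * penalty F₀)
      (g := fun ω => |∑ q, (E' q ω - p) * (F₀.theta q.1 q.2 - θs q.1 q.2) ^ 2|)
      measurable_const (by fun_prop)), ?_, ?_⟩
  · have hexp : Real.exp (-(2 * penalty F₀)) ≤ Real.exp (-((n : ℝ) + m)) :=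
      Real.exp_le_exp.2 (by linarith)
    have hd' : (10 : ℝ) ≤ (n : ℝ) + m := by exact_mod_cast hd
    have hfac : Real.exp (-((n : ℝ) + m)) * 8 ≤ Real.exp (-((n : ℝ) + m) / 10) := by
      have h8 : (8 : ℝ) ≤ Real.exp (9 * ((n : ℝ) + m) / 10) := by
        have := Real.add_one_le_exp (9 * ((n : ℝ) + m) / 10)
        linarith
      calc Real.exp (-((n : ℝ) + m)) * 8
          ≤ Real.exp (-((n : ℝ) + m)) * Real.exp (9 * ((n : ℝ) + m) / 10) := by gcongr
        _ = Real.exp (-((n : ℝ) + m) / 10) := by rw [← Real.exp_add]; congr 1; ring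
    refine (measureReal_union_le _ _).trans
      ((add_le_add (measureReal_union_le _ _) le_rfl).trans ?_)
    refine (add_le_add (add_le_add hnp hMU) hO).trans ?_
    linarith [Real.exp_pos (-((n : ℝ) + m) / 10)]
  · intro ω hω hE01 F hF hcrit
    simp only [Set.mem_union, Set.mem_iUnion, Set.mem_ofPred_eq, not_or, not_exists, not_le] at hω
    obtain ⟨⟨hω1, hω2⟩, hω3⟩ := hω
    obtain ⟨jn, jm, hθc, hRc⟩ := exists_chart (by omega) (by omega) hF
    have h1 := hNB _ (jn, jm) _ (hω1 (jn, jm)) F.theta hθc (hbd F hF)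
    have h2 := hMB (jn, jm) ω (hω2 (jn, jm)) F.theta hθc (hbd F hF)
    have hE01' : ∀ q, E' q ω = 0 ∨ E' q ω = 1 := fun q => hE01 _ _
    rw [sum_mask_sub_mul hE01'] at h2 hω3
    unfold criterion at hcrit
    rw [frobSq_residual hE01, frobSq_residual hE01] at hcrit
    rw [frobSq_eq_sum_prod, frobSq_eq_sum_prod]
    refine oracle_bound_of_deviation_bounds (observedSet fun q => E' q ω)
      (fun q => F.theta q.1 q.2 - θs q.1 q.2) (fun q => F₀.theta q.1 q.2 - θs q.1 q.2)
      (fun q => ξ q.1 q.2 ω) (R := penalty F) hθ (le_max_right σ θmx) hp0.le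
      (le_trans (by positivity) hpen) (hcost0 (jn, jm)) hRc ?_ ?_ h2 hω3.le
    · convert hcrit using 4 <;> ring
    · simpa using h1

theorem theorem5 :
    ∃ C : ℝ, 0 < C ∧
      ∀ (n m kn km : ℕ) (Dn Dm : Set ℝ) (Bmax θmx σ p : ℝ),
        2 ≤ n → 2 ≤ m → 10 ≤ n + m →
        6 * Real.log ((kn : ℝ) * km) ≤
          (n : ℝ) * m * Real.log (3 * √((min n m : ℕ) : ℝ)) →
        0 < Bmax → 0 < θmx → 0 < σ → 0 < p → p ≤ 1 →
      ∀ (θs : Matrix (Fin n) (Fin m) ℝ), (∀ i j, |θs i j| ≤ θmx) →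
      ∀ (Ω : Type*) [MeasurableSpace Ω] (μ : Measure Ω) [IsProbabilityMeasure μ]
        (E ξ : Fin n → Fin m → Ω → ℝ), IsCompletionModel μ p σ E ξ →
      ∀ (θhat : Ω → Matrix (Fin n) (Fin m) ℝ),
        (∀ᵐ ω ∂μ, IsPenalizedLSE (factorUnion Dn Dm n m kn km Bmax θmx)
          (8 * (max σ θmx) ^ 2) (fun i j => E i j ω)
          (observed (fun i j => E i j ω) (fun i j => ξ i j ω) θs) (θhat ω)) →
        ∃ A : Set Ω, MeasurableSet A ∧
          1 - 5 * Real.exp (-((n : ℝ) + m) / 10) - 2 * Real.exp (-(p * n * m)) ≤ μ.real A ∧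
          ∀ ω ∈ A, frobSq (θhat ω - θs) ≤
            C * ⨅ F : factorUnion Dn Dm n m kn km Bmax θmx,
              (frobSq (F.1.theta - θs) + (max σ θmx) ^ 2 / p * penalty F.1) := by
  refine ⟨20000 + 16 * Real.exp 400, by positivity, ?_⟩
  intro n m kn km Dn Dm Bmax θmx σ p hn hm hd _ _ hθ hσ hp0 hp1 θs hθs Ω _ μ _ E ξ hmod θhat hhat
  set ς := max σ θmx with hς
  have hς0 : 0 < ς := hσ.trans_le (le_max_left _ _)
  have hθς : θmx ≤ ς := le_max_right _ _
  obtain ⟨ω₀, F₁, hF₁, -⟩ := hhat.exists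
  have hk : 1 ≤ kn ∧ 1 ≤ km := by
    obtain ⟨sn, hsn, sm, hsm, -⟩ := hF₁
    rw [Finset.mem_Icc] at hsn hsm
    exact ⟨hsn.1.trans hsn.2, hsm.1.trans hsm.2⟩
  have : Nonempty (factorUnion Dn Dm n m kn km Bmax θmx) := ⟨⟨F₁, hF₁⟩⟩
  set val : factorUnion Dn Dm n m kn km Bmax θmx → ℝ := fun F =>
    frobSq (F.1.theta - θs) + ς ^ 2 / p * penalty F.1 with hval
  have hpen := fun F : Factors n m kn km => half_add_le_penalty hn hm hk.1 hk.2 F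
  have hn' : (2 : ℝ) ≤ n := by exact_mod_cast hn
  have hm' : (2 : ℝ) ≤ m := by exact_mod_cast hm
  have hfrob : ∀ A : Matrix (Fin n) (Fin m) ℝ, 0 ≤ frobSq A := fun A =>
    Finset.sum_nonneg fun i _ => Finset.sum_nonneg fun j _ => sq_nonneg _
  have hinf : 0 < ⨅ F, val F := by
    refine lt_of_lt_of_le (b := ς ^ 2 / p * (((n : ℝ) + m) / 2)) (by positivity)
      (le_ciInf fun F => ?_)
    have := hpen F.1
    refine le_add_of_nonneg_of_le (hfrob _) ?_
    gcongr
  -- the infimum need not be attained, but it is positive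
  obtain ⟨⟨F₀, hF₀⟩, hlt⟩ := exists_lt_of_ciInf_lt (show ⨅ F, val F < 2 * ⨅ F, val F by linarith)
  simp only [hval] at hlt
  set I := ⨅ F, val F
  -- a measurable set of probability one on which the minimizer exists and the masks are `0` or `1`
  obtain ⟨G, hGsub, hGm, hGc⟩ : ∃ G : Set Ω,
      (∀ ω ∈ G, (∀ i j, E i j ω = 0 ∨ E i j ω = 1) ∧
        IsPenalizedLSE (factorUnion Dn Dm n m kn km Bmax θmx) (8 * ς ^ 2) (fun i j => E i j ω)
          (observed (fun i j => E i j ω) (fun i j => ξ i j ω) θs) (θhat ω)) ∧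
      MeasurableSet G ∧ μ Gᶜ = 0 := by
    have hae : ∀ᵐ ω ∂μ, (∀ i j, E i j ω = 0 ∨ E i j ω = 1) ∧
        IsPenalizedLSE (factorUnion Dn Dm n m kn km Bmax θmx) (8 * ς ^ 2) (fun i j => E i j ω)
          (observed (fun i j => E i j ω) (fun i j => ξ i j ω) θs) (θhat ω) :=
      (ae_all_iff.2 fun i => ae_all_iff.2 fun j => hmod.mask_zero_one i j).and hhat
    obtain ⟨T, hsub, hTm, hT0⟩ := exists_measurable_superset_of_null (ae_iff.1 hae)
    refine ⟨Tᶜ, fun ω hω => ?_, hTm.compl, by rwa [compl_compl]⟩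
    by_contra hcon
    exact hω (hsub hcon)
  have hGr : μ.real Gᶜ = 0 := by rw [measureReal_def, hGc]; simp
  have hG1 : μ.real G = 1 := by
    have := probReal_compl_eq_one_sub (μ := μ) hGm
    linarith
  have hexp2 : 0 < Real.exp (-(p * n * m)) := Real.exp_pos _
  by_cases hbig : p * n * m / (2 * Real.exp 400) ≤ penalty F₀
  · -- the penalty is of the order of `p n m`, and the uniform bound on the entries suffices
    refine ⟨G, hGm, ?_, fun ω hω => ?_⟩
    · rw [hG1]; linarith [Real.exp_pos (-((n : ℝ) + m) / 10)]
    · obtain ⟨-, F, ⟨sn, -, sm, -, -, -, -, hb⟩, hFθ, -⟩ := hGsub ω hω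
      have h4 : frobSq (θhat ω - θs) ≤ n * (m * (4 * θmx ^ 2)) := by
        calc frobSq (θhat ω - θs) ≤ ∑ _i : Fin n, ∑ _j : Fin m, 4 * θmx ^ 2 := by
              refine Finset.sum_le_sum fun i _ => Finset.sum_le_sum fun j _ => ?_
              rw [← hFθ, Matrix.sub_apply, ← sq_abs]
              have h := (abs_sub (F.theta i j) (θs i j)).trans (add_le_add (hb i j) (hθs i j))
              nlinarith [abs_nonneg (F.theta i j - θs i j)]
          _ = n * (m * (4 * θmx ^ 2)) := by simp
      have h5 : n * (m * (4 * θmx ^ 2)) ≤ 8 * Real.exp 400 * (ς ^ 2 / p * penalty F₀) := by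
        calc n * (m * (4 * θmx ^ 2)) ≤ n * (m * (4 * ς ^ 2)) := by gcongr
          _ = 8 * Real.exp 400 * (ς ^ 2 / p * (p * n * m / (2 * Real.exp 400))) := by
            field_simp; ring
          _ ≤ _ := by gcongr
      have h6 := hfrob (F₀.theta - θs)
      have h7 : ς ^ 2 / p * penalty F₀ ≤ 2 * I := by linarith
      have h8 : 8 * Real.exp 400 * (ς ^ 2 / p * penalty F₀) ≤ 8 * Real.exp 400 * (2 * I) := by
        gcongr
      linarith
  · -- here `(n + m) / 2` is much smaller than `n m`, which makes `n ∧ m` large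
    have hμ : Real.exp 400 ≤ (min n m : ℕ) := by
      rw [not_le, lt_div_iff₀ (by positivity)] at hbig
      have h1 := hpen F₀
      have h2 : ((n : ℝ) + m) * Real.exp 400 ≤ penalty F₀ * (2 * Real.exp 400) := by
        nlinarith [Real.exp_pos 400]
      have h3 : p * n * m ≤ n * m := by
        rw [mul_assoc]; exact mul_le_of_le_one_left (by positivity) hp1
      have h4 : (n : ℝ) * m ≤ ((n : ℝ) + m) * (min n m : ℕ) := by
        rcases le_total n m with h | h
        · rw [min_eq_left h]; nlinarith
        · rw [min_eq_right h]; nlinarith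
      have h5 : ((n : ℝ) + m) * Real.exp 400 ≤ ((n : ℝ) + m) * (min n m : ℕ) := by linarith
      exact le_of_mul_le_mul_left h5 (by positivity)
    obtain ⟨Bad, hBm, hBp, hB⟩ :=
      exists_good_event hn hm hd hk.1 hk.2 hμ hθ hσ hp0 hp1 hθs hmod hF₀
    refine ⟨G \ Bad, hGm.diff hBm, ?_, fun ω hω => ?_⟩
    · have := le_measureReal_sdiff (μ := μ) (s₁ := G) (s₂ := Bad)
      rw [hG1] at this
      linarith
    · obtain ⟨h01, F, hF, hFθ, hmin⟩ := hGsub ω hω.1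
      have h := hB ω hω.2 h01 F hF (hmin F₀ hF₀)
      rw [hFθ] at h
      have h1 : frobSq (θhat ω - θs) ≤
          10000 * (frobSq (F₀.theta - θs) + ς ^ 2 / p * penalty F₀) := by
        refine le_of_mul_le_mul_left (h.trans_eq ?_) hp0
        rw [hς]
        field_simp
      have h2 : 0 < Real.exp 400 * I := by positivity
      linarith
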